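/- Let $h$ be a whole-plane Gaussian free field normalized so that its average over the unit circle is zero, i.e. the centered Gaussian process $\mu \mapsto (h,\mu)$ indexed by the finite compactly supported Borel measures on $\mathbb C$ of finite logarithmic energy, with covariance $\mathbb E[(h,\mu)(h,\nu)] = \iint G(x,y)\,\mu(dx)\,\nu(dy)$, where $G(x,y) = -\log|x-y| + \log\max(|x|,1) + \log\max(|y|,1)$. For $\varepsilon > 0$ and $z \in \mathbb C$ let $h_\varepsilon(z)$ be the average of $h$ over the circle of radius $\varepsilon$ centered at $z$, i.e. the pairing of $h$ with the uniform probability measure on that circle. Let $\mathbb S^\varepsilon = (\varepsilon\mathbb Z^2)\cap[0,1]^2$ with its nearest-neighbor graph structure. For $\xi \ge 0$ and a lattice path $P : \{0,\dots,N\} \to \mathbb S^\varepsilon$, let $$L_h^{\xi,\varepsilon}(P) = \sum_{j=0}^N \varepsilon\, e^{\xi h_\varepsilon(P(j))}$$ be its $\xi$-LFPP (Liouville first passage percolation) length. For $z,w \in \mathbb S^\varepsilon$ let $D_h^{\xi,\varepsilon}(z,w)$ be the infimum of $L_h^{\xi,\varepsilon}(P)$ over all lattice paths $P$ in $\mathbb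 S^\varepsilon$ from $z$ to $w$, and for two sets of vertices let $D_h^{\xi,\varepsilon}(A,B) = \inf_{z\in A, w\in B} D_h^{\xi,\varepsilon}(z,w)$. Let $\partial_{\mathrm L}\mathbb S^\varepsilon$ (resp. $\partial_{\mathrm R}\mathbb S^\varepsilon$) be the set of vertices of $\mathbb S^\varepsilon$ whose nearest neighbor to the left (resp. right) in $\varepsilon\mathbb Z^2$ is not in $\mathbb S^\varepsilon$, and let $$\lambda(\xi) = \sup\Big\{\alpha\in\mathbb R : \liminf_{\varepsilon\to0}\mathbb P\big[D_h^{\xi,\varepsilon}(\partial_{\mathrm L}\mathbb S^\varepsilon,\partial_{\mathrm R}\mathbb S^\varepsilon)\le\varepsilon^\alpha\big]=1\Big\}.$$ **Theorem.** Let $0 \le \tilde\xi \le \xi$ and $\zeta > 0$. With probability tending to $1$ as $\varepsilon \to 0$, every simple lattice path $P$ in $\mathbb S^\varepsilon$ with $L_h^{\xi,\varepsilon}(P) \le \varepsilon^{\lambda(\xi)-\zeta}$ satisfies $$L_h^{\tilde\xi,\varepsilon}(P) \le \varepsilon^{\lambda(\xi) - (\xi-\tilde\xi)\left(\sqrt{2+2\lambda(\xi)+\xi^2}-\xi\right)-\zeta}.$$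 -/

import Mathlib

open MeasureTheory ProbabilityTheory Filter Topology

noncomputable section

namespace LFPP

/-! ### The whole-plane Gaussian free field and its circle averages -/

/-- The covariance kernel of the whole-plane Gaussian free field normalized so that its average
over the unit circle vanishes:
`G(x, y) = -log |x - y| + log max(|x|, 1) + log max(|y|, 1)`.
Only its values for `x ≠ y` matter below. -/
def greenKernel (x y : ℂ) : ℝ :=
  -Real.log ‖x - y‖ + Real.log (max ‖x‖ 1) + Real.log (max ‖y‖ 1)

/-- Finite, compactly supported (positive) Borel measures `μ` on the plane of finite logarithmic
energy, `∬ |log |x - y|| μ(dx) μ(dy) < ∞`. Such a measure has no atoms, since `log 0 = -∞`; as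
`Real.log 0 = 0`, this consequence is written out, and it makes the diagonal a null set. -/
structure HasFiniteLogEnergy (μ : Measure ℂ) : Prop where
  finite : μ Set.univ < ⊤
  compactSupport : ∃ K : Set ℂ, IsCompact K ∧ μ Kᶜ = 0
  noAtoms : ∀ x : ℂ, μ {x} = 0
  energy : Integrable (fun p : ℂ × ℂ => Real.log ‖p.1 - p.2‖) (μ.prod μ)

/-- `h` is a whole-plane Gaussian free field, normalized so that its average over the unit circle
is zero, defined as a stochastic process through its law: `h μ = (h, μ)` is the pairing of the
field with the measure `μ`, and these pairings form a centered Gaussian process, indexed by the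
measures of finite logarithmic energy, with covariance
`E[(h, μ) (h, ν)] = ∬ G(x, y) μ(dx) ν(dy)`. (The values of `h` at other measures play no role.) -/
structure IsWholePlaneGFF {Ω : Type*} [MeasurableSpace Ω]
    (h : Measure ℂ → Ω → ℝ) (P : Measure Ω) : Prop where
  gaussian : IsGaussianProcess (fun μ : {μ : Measure ℂ // HasFiniteLogEnergy μ} => h μ.1) P
  centered : ∀ μ : Measure ℂ, HasFiniteLogEnergy μ → ∫ ω, h μ ω ∂P = 0
  covariance_eq : ∀ μ ν : Measure ℂ, HasFiniteLogEnergy μ → HasFiniteLogEnergy ν →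
    covariance (h μ) (h ν) P = ∫ x, ∫ y, greenKernel x y ∂ν ∂μ

/-- The uniform probability measure on the circle of radius `ε` centered at `z`. -/
def circleMeasure (z : ℂ) (ε : ℝ) : Measure ℂ :=
  ((ENNReal.ofReal (2 * Real.pi))⁻¹ • volume.restrict (Set.Ioc 0 (2 * Real.pi))).map
    (circleMap z ε)

/-- The circle average `h_ε(z)` of the field `h`. -/
def circleAvg {Ω : Type*} (h : Measure ℂ → Ω → ℝ) (ε : ℝ) (z : ℂ) (ω : Ω) : ℝ :=
  h (circleMeasure z ε) ω

/-! ### The lattice -/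

/-- `𝕊^ε = (ε ℤ²) ∩ [0,1]²`, as a subset of the complex plane. -/
def lattice (ε : ℝ) : Set ℂ :=
  {z | (∃ m n : ℤ, z = ⟨ε * m, ε * n⟩) ∧ z.re ∈ Set.Icc (0 : ℝ) 1 ∧ z.im ∈ Set.Icc (0 : ℝ) 1}

/-- The vertices of `𝕊^ε` whose nearest neighbor to the left in `ε ℤ²` is not in `𝕊^ε`. -/
def leftBoundary (ε : ℝ) : Set ℂ := {z | z ∈ lattice ε ∧ z - (ε : ℂ) ∉ lattice ε}

/-- The vertices of `𝕊^ε` whose nearest neighbor to the right in `ε ℤ²` is not in `𝕊^ε`. -/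
def rightBoundary (ε : ℝ) : Set ℂ := {z | z ∈ lattice ε ∧ z + (ε : ℂ) ∉ lattice ε}

/-- `p : {0, …, N} → 𝕊^ε` is a lattice path: consecutive vertices are nearest neighbors,
i.e. lattice points at Euclidean distance `ε`. -/
def IsLatticePath (ε : ℝ) {N : ℕ} (p : Fin (N + 1) → ℂ) : Prop :=
  (∀ j, p j ∈ lattice ε) ∧ ∀ j : Fin N, ‖p j.succ - p j.castSucc‖ = ε

/-! ### Liouville first passage percolation -/

/-- The length `∑_{j=0}^N ε exp(ξ f(p(j)))` of a path `p`; the LFPP length is the case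
`f = h_ε`. -/
def pathLength (f : ℂ → ℝ) (ε ξ : ℝ) {N : ℕ} (p : Fin (N + 1) → ℂ) : ℝ :=
  ∑ j, ε * Real.exp (ξ * f (p j))

/-- The distance between two vertices: the infimum of the lengths of the lattice paths
joining them. -/
def vertexDist (f : ℂ → ℝ) (ε ξ : ℝ) (z w : ℂ) : ℝ :=
  sInf {l | ∃ (N : ℕ) (p : Fin (N + 1) → ℂ), IsLatticePath ε p ∧ p 0 = z ∧ p (Fin.last N) = w ∧
    l = pathLength f ε ξ p}

/-- The distance between the left and the right boundary of `𝕊^ε`. -/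
def crossingDist (f : ℂ → ℝ) (ε ξ : ℝ) : ℝ :=
  sInf {d | ∃ z ∈ leftBoundary ε, ∃ w ∈ rightBoundary ε, d = vertexDist f ε ξ z w}

/-- The LFPP distance exponent `λ(ξ)`: the supremum of the real `α` such that
`liminf_{ε → 0} P[D_h^{ξ,ε}(∂_L 𝕊^ε, ∂_R 𝕊^ε) ≤ ε^α] = 1`. -/
def distExponent {Ω : Type*} [MeasurableSpace Ω] (h : Measure ℂ → Ω → ℝ) (P : Measure Ω)
    (ξ : ℝ) : ℝ :=
  sSup {α : ℝ | liminf (fun ε : ℝ =>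
    P {ω | crossingDist (fun z => circleAvg h ε z ω) ε ξ ≤ ε ^ α}) (𝓝[>] (0 : ℝ)) = 1}

end LFPP

end

noncomputable section

namespace LFPP

/-! ### Circle measures -/

/-! Write `λ` for the distance exponent and `b = √(2 + 2λ + ξ²) - ξ`, so that `λ = b²/2 + ξb - 1`.
Split the vertices of a simple path `p` at the level `h_ε = -c`, with `c` slightly below `b log
(1/ε)`. Above this level, `exp (ξ' h_ε) ≤ exp ((ξ - ξ') c) exp (ξ h_ε)`, so these vertices
contribute at most about `ε^{-(ξ - ξ') b}` times the `ξ`-length. Below it, `exp (ξ' h_ε) ≤ exp (-(ξ'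
+ b) c) exp (-b h_ε)`. Since `p` is injective, the sum over these vertices is at most the sum of
`exp (-b h_ε)` over the whole lattice, which the first moment bounds by about `ε^{-2 - b²/2}`. By
the formula for `λ` both contributions have exponent `λ - (ξ - ξ') b`, up to errors absorbed by `ζ`.
The two ingredients are `pathLength_le_of_injective` and `IsWholePlaneGFF.tendsto_sum_exp`.

The argument needs `b ≥ 0`, that is, `λ ≥ -1`, and this is the longer part
(`IsWholePlaneGFF.neg_one_le_distExponent`). It suffices to find a left-right crossing on which `h_ε
≤ δ log (1/ε)`: it has `O(ε^{-2})` vertices, so its length is at most `ε^{-1 - o(1)}`. By planar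
duality (`hasCrossing_or`), either `{h_ε ≤ 0}` has a left-right crossing by king moves or `{h_ε >
0}` has a bottom-top one. The law is invariant under change of sign and reflection across the
diagonal, so the first case has probability at least `1/2`. The min-max level of a crossing
fluctuates by `O(√log (1/ε))` (`gaussian_minMax_concentration`), so crossings at level `δ log (1/ε)`
exist with high probability. King moves become nearest-neighbor moves because increments between
neighbors are also at most `δ log (1/ε)`. -/

lemma measurable_circleMap (z : ℂ) (ε : ℝ) : Measurable (circleMap z ε) :=
  (continuous_circleMap z ε).measurable

instance isProbabilityMeasure_circleMeasure (z : ℂ) (ε : ℝ) :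
    IsProbabilityMeasure (circleMeasure z ε) := by
  constructor
  rw [circleMeasure, Measure.map_apply (measurable_circleMap z ε) MeasurableSet.univ]
  simp only [Set.preimage_univ, Measure.smul_apply, Measure.restrict_apply_univ, Real.volume_Ioc,
    sub_zero, smul_eq_mul]
  exact ENNReal.inv_mul_cancel (by simp [Real.pi_pos]) ENNReal.ofReal_ne_top

lemma integral_circleMeasure {f : ℂ → ℝ} (hf : StronglyMeasurable f) (z : ℂ) (ε : ℝ) :
    ∫ x, f x ∂circleMeasure z ε = Real.circleAverage f z ε := by
  rw [circleMeasure, integral_map (measurable_circleMap z ε).aemeasurable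
    hf.aestronglyMeasurable, integral_smul_measure, Real.circleAverage_def,
    intervalIntegral.integral_of_le Real.two_pi_pos.le]
  congr 1
  rw [ENNReal.toReal_inv, ENNReal.toReal_ofReal Real.two_pi_pos.le]

lemma integrable_circleMeasure {f : ℂ → ℝ} (hf : StronglyMeasurable f) {z : ℂ} {ε : ℝ}
    (h : CircleIntegrable f z ε) : Integrable f (circleMeasure z ε) := by
  rw [circleMeasure, integrable_map_measure hf.aestronglyMeasurable
    (measurable_circleMap z ε).aemeasurable]
  refine Integrable.smul_measure ?_ (by simp [Real.pi_pos])
  exact (intervalIntegrable_iff_integrableOn_Ioc_of_le Real.two_pi_pos.le).1 h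

lemma ae_circleMeasure {z : ℂ} {ε : ℝ} (hε : 0 < ε) :
    ∀ᵐ x ∂circleMeasure z ε, ‖x - z‖ = ε := by
  rw [circleMeasure, ae_map_iff (measurable_circleMap z ε).aemeasurable
    (measurableSet_eq_fun (by fun_prop) (by fun_prop))]
  refine Eventually.of_forall fun θ => ?_
  simp [circleMap, abs_of_pos hε]

lemma circleMeasure_singleton (z : ℂ) {ε : ℝ} (hε : 0 < ε) (x : ℂ) :
    circleMeasure z ε {x} = 0 := by
  rw [circleMeasure, Measure.map_apply (measurable_circleMap z ε) (measurableSet_singleton x)]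
  have h0 : volume (circleMap z ε ⁻¹' {x}) = 0 :=
    ((Set.countable_singleton x).preimage_circleMap z hε.ne').measure_zero _
  simp only [Measure.smul_apply, smul_eq_mul]
  rw [Measure.restrict_apply ((measurable_circleMap z ε) (measurableSet_singleton x)),
    measure_mono_null Set.inter_subset_left h0, mul_zero]

lemma stronglyMeasurable_log_norm_sub (w : ℂ) :
    StronglyMeasurable fun y : ℂ => Real.log ‖y - w‖ :=
  (Real.measurable_log.comp (by fun_prop : Measurable fun y : ℂ => ‖y - w‖)).stronglyMeasurable

lemma integrable_log_norm_sub (w z : ℂ) (ε : ℝ) :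
    Integrable (fun y => Real.log ‖w - y‖) (circleMeasure z ε) := by
  simp_rw [norm_sub_rev w]
  exact integrable_circleMeasure (stronglyMeasurable_log_norm_sub w)
    (circleIntegrable_log_norm_sub_const ε)

/-- The logarithmic potential of the uniform measure on a circle. -/
lemma integral_log_norm_sub (w z : ℂ) {ε : ℝ} (hε : 0 < ε) :
    ∫ y, Real.log ‖w - y‖ ∂circleMeasure z ε
      = Real.log ε + Real.posLog (ε⁻¹ * ‖w - z‖) := by
  simp_rw [norm_sub_rev w]
  rw [integral_circleMeasure (stronglyMeasurable_log_norm_sub w),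
    circleAverage_log_norm_sub_const_eq_log_radius_add_posLog hε.ne']

lemma hasFiniteLogEnergy_circleMeasure (z : ℂ) {ε : ℝ} (hε : 0 < ε) :
    HasFiniteLogEnergy (circleMeasure z ε) where
  finite := measure_lt_top _ _
  compactSupport := by
    refine ⟨Metric.sphere z ε, isCompact_sphere z ε, ?_⟩
    have := ae_circleMeasure (z := z) hε
    rw [ae_iff] at this
    convert this using 2
    ext x
    simp
  noAtoms := circleMeasure_singleton z hε
  energy := by
    have hm : Measurable fun p : ℂ × ℂ => Real.log ‖p.1 - p.2‖ :=
      Real.measurable_log.comp (by fun_prop : Measurable fun p : ℂ × ℂ => ‖p.1 - p.2‖)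
    rw [integrable_prod_iff hm.aestronglyMeasurable]
    refine ⟨Eventually.of_forall fun x => integrable_log_norm_sub x z ε, ?_⟩
    -- For `0 ≤ t ≤ 2ε`, `|log t| ≤ 2 log⁺ (2ε) - log t`, which reduces the integral of the absolute
    -- value to the explicit potential, equal to `log ε` on the circle.
    refine Integrable.mono' (integrable_const (2 * Real.posLog (2 * ε) - Real.log ε)) ?_ ?_
    · exact (hm.norm.stronglyMeasurable.integral_prod_right').aestronglyMeasurable
    · filter_upwards [ae_circleMeasure (z := z) hε] with x hx
      rw [Real.norm_of_nonneg (integral_nonneg fun y => norm_nonneg _)]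
      have hlog : ∫ y, Real.log ‖x - y‖ ∂circleMeasure z ε = Real.log ε := by
        rw [integral_log_norm_sub x z hε, hx, inv_mul_cancel₀ hε.ne', Real.posLog_one, add_zero]
      calc ∫ y, ‖Real.log ‖x - y‖‖ ∂circleMeasure z ε
          ≤ ∫ y, (2 * Real.posLog (2 * ε) - Real.log ‖x - y‖) ∂circleMeasure z ε := by
            refine integral_mono_ae (integrable_log_norm_sub x z ε).norm
              ((integrable_const _).sub (integrable_log_norm_sub x z ε)) ?_
            filter_upwards [ae_circleMeasure (z := z) hε] with y hy
            have h1 : ‖x - y‖ ≤ 2 * ε := by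
              calc ‖x - y‖ = ‖(x - z) - (y - z)‖ := by congr 1; ring
                _ ≤ ‖x - z‖ + ‖y - z‖ := norm_sub_le _ _
                _ = 2 * ε := by rw [hx, hy]; ring
            have h2 : Real.posLog ‖x - y‖ ≤ Real.posLog (2 * ε) :=
              Real.posLog_le_posLog (norm_nonneg _) h1
            have h3 : Real.log ‖x - y‖ ≤ Real.posLog ‖x - y‖ := by
              rw [Real.posLog_def]; exact le_max_right _ _
            have h4 : 0 ≤ Real.posLog (2 * ε) := Real.posLog_nonneg
            rw [Real.norm_eq_abs]
            exact abs_le.2 ⟨by linarith, by linarith⟩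
        _ = 2 * Real.posLog (2 * ε) - Real.log ε := by
            rw [integral_sub (integrable_const _) (integrable_log_norm_sub x z ε), hlog]
            simp

/-! ### The covariances of the circle averages -/

lemma continuous_posLog_comp {f : ℂ → ℝ} (hf : Continuous f) :
    Continuous fun x => Real.posLog (f x) := by
  have h : (fun x => Real.posLog (f x)) = fun x => Real.log (max 1 |f x|) := by
    funext x
    rw [← Real.posLog_abs, Real.posLog_eq_log_max_one (abs_nonneg _)]
  rw [h]
  exact (continuous_const.max hf.abs).log fun x => by positivity

lemma log_max_norm (x : ℂ) : Real.log (max ‖x‖ 1) = Real.posLog ‖x‖ := by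
  rw [Real.posLog_eq_log_max_one (norm_nonneg _), max_comm]

/-- The average over a circle of the truncated logarithm `log⁺ |x|`. -/
def avgPosLog (ε : ℝ) (z : ℂ) : ℝ := Real.circleAverage (fun x => Real.posLog ‖x‖) z ε

/-- The average over a circle of the truncated logarithm `log⁺ (|x - w| / ε)`. -/
def avgPosLogSub (ε : ℝ) (z w : ℂ) : ℝ :=
  Real.circleAverage (fun x => Real.posLog (ε⁻¹ * ‖x - w‖)) z ε

/-- The covariance of the circle averages of radius `ε` at `z` and `w`. -/
def circleCov (ε : ℝ) (z w : ℂ) : ℝ :=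
  -Real.log ε - avgPosLogSub ε z w + avgPosLog ε z + avgPosLog ε w

lemma integrable_of_continuous {f : ℂ → ℝ} (hf : Continuous f) (z : ℂ) (ε : ℝ) :
    Integrable f (circleMeasure z ε) :=
  integrable_circleMeasure hf.stronglyMeasurable hf.continuousOn.circleIntegrable'

/-- The potential of a circle is the logarithm truncated at scale `ε`, so the inner integral removes
the singularity and the outer integrand is continuous. -/
lemma integral_greenKernel_circleMeasure (z w : ℂ) {ε : ℝ} (hε : 0 < ε) :
    ∫ x, ∫ y, greenKernel x y ∂circleMeasure w ε ∂circleMeasure z ε = circleCov ε z w := by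
  have hc1 : Continuous fun x : ℂ => Real.posLog ‖x‖ := continuous_posLog_comp continuous_norm
  have hc2 : Continuous fun x : ℂ => Real.posLog (ε⁻¹ * ‖x - w‖) :=
    continuous_posLog_comp (by fun_prop)
  have hinner : ∀ x, ∫ y, greenKernel x y ∂circleMeasure w ε
      = -Real.log ε - Real.posLog (ε⁻¹ * ‖x - w‖) + Real.posLog ‖x‖ + avgPosLog ε w := by
    intro x
    simp only [greenKernel, log_max_norm]
    have i1 : Integrable (fun y => -Real.log ‖x - y‖) (circleMeasure w ε) :=
      (integrable_log_norm_sub x w ε).neg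
    have i2 : Integrable (fun y => -Real.log ‖x - y‖ + Real.posLog ‖x‖) (circleMeasure w ε) :=
      i1.add (integrable_const _)
    rw [integral_add i2 (integrable_of_continuous hc1 w ε), integral_add i1 (integrable_const _),
      integral_neg, integral_log_norm_sub x w hε, integral_circleMeasure hc1.stronglyMeasurable]
    simp [avgPosLog]
    ring
  simp_rw [hinner]
  have i1 : Integrable (fun x => -Real.log ε - Real.posLog (ε⁻¹ * ‖x - w‖)) (circleMeasure z ε) :=
    (integrable_const _).sub (integrable_of_continuous hc2 z ε)
  have i2 : Integrable (fun x => -Real.log ε - Real.posLog (ε⁻¹ * ‖x - w‖) + Real.posLog ‖x‖)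
      (circleMeasure z ε) := i1.add (integrable_of_continuous hc1 z ε)
  rw [integral_add i2 (integrable_const _), integral_add i1 (integrable_of_continuous hc1 z ε),
    integral_sub (integrable_const _) (integrable_of_continuous hc2 z ε),
    integral_circleMeasure hc1.stronglyMeasurable, integral_circleMeasure hc2.stronglyMeasurable]
  simp [circleCov, avgPosLog, avgPosLogSub]

lemma circleAverage_le_of_le_sphere {f : ℂ → ℝ} (hf : Continuous f) {z : ℂ} {ε a : ℝ} (hε : 0 < ε)
    (h : ∀ x, ‖x - z‖ = ε → f x ≤ a) : Real.circleAverage f z ε ≤ a := by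
  rw [← integral_circleMeasure hf.stronglyMeasurable]
  calc ∫ x, f x ∂circleMeasure z ε ≤ ∫ _, a ∂circleMeasure z ε := by
        refine integral_mono_ae (integrable_of_continuous hf z ε) (integrable_const _) ?_
        filter_upwards [ae_circleMeasure (z := z) hε] with x hx using h x hx
    _ = a := by simp

lemma avgPosLogSub_nonneg (ε : ℝ) (z w : ℂ) : 0 ≤ avgPosLogSub ε z w :=
  Real.circleAverage_nonneg_of_nonneg fun _ _ => Real.posLog_nonneg

lemma avgPosLog_le {ε : ℝ} (hε : 0 < ε) {z : ℂ} {r : ℝ} (hr : ‖z‖ + ε ≤ r) :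
    avgPosLog ε z ≤ Real.posLog r := by
  refine circleAverage_le_of_le_sphere (continuous_posLog_comp continuous_norm) hε fun x hx => ?_
  refine Real.posLog_le_posLog (norm_nonneg _) (le_trans ?_ hr)
  calc ‖x‖ = ‖z + (x - z)‖ := by congr 1; ring
    _ ≤ ‖z‖ + ‖x - z‖ := norm_add_le _ _
    _ = ‖z‖ + ε := by rw [hx]

lemma avgPosLogSub_le {ε : ℝ} (hε : 0 < ε) {z w : ℂ} {r : ℝ} (hr : ‖z - w‖ ≤ r * ε) :
    avgPosLogSub ε z w ≤ Real.posLog (r + 1) := by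
  refine circleAverage_le_of_le_sphere (continuous_posLog_comp (by fun_prop)) hε fun x hx => ?_
  refine Real.posLog_le_posLog (by positivity) ?_
  have : ‖x - w‖ ≤ (r + 1) * ε := by
    calc ‖x - w‖ = ‖(x - z) + (z - w)‖ := by congr 1; ring
      _ ≤ ‖x - z‖ + ‖z - w‖ := norm_add_le _ _
      _ ≤ (r + 1) * ε := by rw [hx]; linarith
  calc ε⁻¹ * ‖x - w‖ ≤ ε⁻¹ * ((r + 1) * ε) := by gcongr
    _ = r + 1 := by field_simp

lemma avgPosLogSub_self {ε : ℝ} (hε : 0 < ε) (z : ℂ) : avgPosLogSub ε z z = 0 :=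
  le_antisymm (by simpa using avgPosLogSub_le (r := 0) (z := z) (w := z) hε (by simp))
    (avgPosLogSub_nonneg ε z z)

/-- The reflection of the plane across the diagonal `{re = im}`. -/
def reflect (z : ℂ) : ℂ := Complex.I * (starRingEnd ℂ) z

lemma norm_reflect (z : ℂ) : ‖reflect z‖ = ‖z‖ := by simp [reflect]

lemma norm_reflect_sub (z w : ℂ) : ‖reflect z - reflect w‖ = ‖z - w‖ := by
  rw [← norm_reflect (z - w)]
  simp [reflect, mul_sub]

lemma circleAverage_I_mul (f : ℂ → ℝ) :
    Real.circleAverage (fun x => f (Complex.I * x)) 0 1 = Real.circleAverage f 0 1 := by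
  rw [Real.circleAverage_eq_integral_add (f := f) (Real.pi / 2), Real.circleAverage_def]
  congr 2
  funext θ
  congr 1
  simp [circleMap, add_mul, Complex.exp_add, Complex.exp_pi_div_two_mul_I]
  ring

/-- On the unit circle conjugation is inversion, which preserves circle averages, and multiplication
by `I` is a rotation. -/
lemma circleAverage_reflect (f : ℂ → ℝ) (z : ℂ) (ε : ℝ) :
    Real.circleAverage f (reflect z) ε = Real.circleAverage (fun x => f (reflect x)) z ε := by
  rw [Real.circleAverage_eq_circleAverage_zero_one, ← circleAverage_I_mul,
    ← Real.circleAverage_zero_one_congr_inv,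
    Real.circleAverage_eq_circleAverage_zero_one (f := fun x => f (reflect x))]
  refine Real.circleAverage_congr_sphere fun x hx => ?_
  have hx1 : ‖x‖ = 1 := by simpa using hx
  have hinv : x⁻¹ = (starRingEnd ℂ) x := by
    rw [Complex.inv_def, Complex.normSq_eq_norm_sq, hx1]; simp
  simp only [hinv, reflect, map_add, map_mul, Complex.conj_ofReal]
  congr 1
  ring

lemma circleCov_reflect (ε : ℝ) (z w : ℂ) :
    circleCov ε (reflect z) (reflect w) = circleCov ε z w := by
  simp only [circleCov, avgPosLog, avgPosLogSub, circleAverage_reflect, norm_reflect,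
    norm_reflect_sub]

/-! ### Gaussian concentration for min-max functionals -/

section SoftMin

variable {ι : Type*}

/-- The exponential sum `∑_{z ∈ γ} exp (k u_z)`, a smooth version of `max_{z ∈ γ} u_z`. -/
def expSum (k : ℝ) (γ : Finset ι) (u : ι → ℝ) : ℝ := ∑ z ∈ γ, Real.exp (k * u z)

/-- A smooth version of `exp (-k min_{γ ∈ Γ} max_{z ∈ γ} u_z)`. -/
def invExpSum (k : ℝ) (Γ : Finset (Finset ι)) (u : ι → ℝ) : ℝ := ∑ γ ∈ Γ, (expSum k γ u)⁻¹

/-- A smooth version of `min_{γ ∈ Γ} max_{z ∈ γ} u_z`. -/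
def softMinMax (k : ℝ) (Γ : Finset (Finset ι)) (u : ι → ℝ) : ℝ :=
  -(Real.log (invExpSum k Γ u) / k)

/-- The derivative of `softMinMax k Γ` at `u` in the direction `v`. -/
def softMinMaxDeriv (k : ℝ) (Γ : Finset (Finset ι)) (u v : ι → ℝ) : ℝ :=
  (∑ γ ∈ Γ, ((expSum k γ u) ^ 2)⁻¹ * ∑ z ∈ γ, Real.exp (k * u z) * v z) / invExpSum k Γ u

variable {k : ℝ} {Γ : Finset (Finset ι)}

lemma expSum_pos {γ : Finset ι} (hγ : γ.Nonempty) (u : ι → ℝ) : 0 < expSum k γ u :=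
  Finset.sum_pos (fun _ _ => Real.exp_pos _) hγ

lemma invExpSum_pos (hΓ : Γ.Nonempty) (hne : ∀ γ ∈ Γ, γ.Nonempty) (u : ι → ℝ) :
    0 < invExpSum k Γ u :=
  Finset.sum_pos (fun γ hγ => inv_pos.2 (expSum_pos (hne γ hγ) u)) hΓ

lemma hasDerivAt_softMinMax (hk : k ≠ 0) (hΓ : Γ.Nonempty) (hne : ∀ γ ∈ Γ, γ.Nonempty)
    {u : ℝ → ι → ℝ} {v : ι → ℝ} {t : ℝ} (hu : ∀ z, HasDerivAt (fun s => u s z) (v z) t) :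
    HasDerivAt (fun s => softMinMax k Γ (u s)) (softMinMaxDeriv k Γ (u t) v) t := by
  have h1 : ∀ γ, HasDerivAt (fun s => expSum k γ (u s))
      (∑ z ∈ γ, Real.exp (k * u t z) * (k * v z)) t := fun γ =>
    HasDerivAt.fun_sum fun z _ => ((hu z).const_mul k).exp
  have h2 : HasDerivAt (fun s => invExpSum k Γ (u s))
      (∑ γ ∈ Γ, -(∑ z ∈ γ, Real.exp (k * u t z) * (k * v z)) / (expSum k γ (u t)) ^ 2) t :=
    HasDerivAt.fun_sum fun γ hγ => (h1 γ).fun_inv (expSum_pos (hne γ hγ) _).ne'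
  convert! ((h2.log (invExpSum_pos hΓ hne _).ne').div_const k).neg using 1
  rw [softMinMaxDeriv, div_right_comm, ← neg_div]
  congr 1
  rw [Finset.sum_div, ← Finset.sum_neg_distrib]
  refine Finset.sum_congr rfl fun γ _ => ?_
  have h3 : ∑ z ∈ γ, Real.exp (k * u t z) * (k * v z)
      = k * ∑ z ∈ γ, Real.exp (k * u t z) * v z := by
    rw [Finset.mul_sum]; exact Finset.sum_congr rfl fun z _ => by ring
  rw [h3]
  field_simp

lemma continuous_expSum (k : ℝ) (γ : Finset ι) : Continuous (expSum k γ) := by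
  unfold expSum; fun_prop

lemma continuous_invExpSum (hne : ∀ γ ∈ Γ, γ.Nonempty) : Continuous (invExpSum k Γ) :=
  continuous_finsetSum _ fun γ hγ =>
    (continuous_expSum k γ).inv₀ fun u => (expSum_pos (hne γ hγ) u).ne'

lemma continuous_softMinMax (hΓ : Γ.Nonempty) (hne : ∀ γ ∈ Γ, γ.Nonempty) :
    Continuous (softMinMax k Γ) :=
  (((continuous_invExpSum hne).log fun u => (invExpSum_pos hΓ hne u).ne').div_const k).neg

lemma continuous_softMinMaxDeriv (hΓ : Γ.Nonempty) (hne : ∀ γ ∈ Γ, γ.Nonempty) :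
    Continuous fun p : (ι → ℝ) × (ι → ℝ) => softMinMaxDeriv k Γ p.1 p.2 := by
  refine Continuous.div (continuous_finsetSum _ fun γ hγ => Continuous.mul ?_ (by fun_prop))
    ((continuous_invExpSum hne).comp continuous_fst) fun p => (invExpSum_pos hΓ hne _).ne'
  exact (((continuous_expSum k γ).comp continuous_fst).pow 2).inv₀ fun p =>
    pow_ne_zero _ (expSum_pos (hne γ hγ) _).ne'

/-- With `softMinMaxDeriv_mono`, this says that the derivative in direction `v` is a weighted
average of the coordinates of `v`. This is what makes the concentration bound free of the dimension.
-/
lemma softMinMaxDeriv_const (hΓ : Γ.Nonempty) (hne : ∀ γ ∈ Γ, γ.Nonempty) (u : ι → ℝ) (σ : ℝ) :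
    softMinMaxDeriv k Γ u (fun _ => σ) = σ := by
  rw [softMinMaxDeriv, div_eq_iff (invExpSum_pos hΓ hne u).ne', invExpSum, Finset.mul_sum]
  refine Finset.sum_congr rfl fun γ hγ => ?_
  have h := (expSum_pos (k := k) (hne γ hγ) u).ne'
  rw [← Finset.sum_mul, ← expSum]
  field_simp

lemma softMinMaxDeriv_mono (hΓ : Γ.Nonempty) (hne : ∀ γ ∈ Γ, γ.Nonempty) (u : ι → ℝ)
    {v w : ι → ℝ} (h : ∀ z, v z ≤ w z) : softMinMaxDeriv k Γ u v ≤ softMinMaxDeriv k Γ u w := by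
  have := invExpSum_pos (k := k) hΓ hne u
  unfold softMinMaxDeriv
  gcongr
  exact h _

lemma softMinMaxDeriv_neg (u v : ι → ℝ) :
    softMinMaxDeriv k Γ u (fun z => -v z) = -softMinMaxDeriv k Γ u v := by
  simp only [softMinMaxDeriv, mul_neg, Finset.sum_neg_distrib, neg_div]

lemma abs_softMinMaxDeriv_le (hΓ : Γ.Nonempty) (hne : ∀ γ ∈ Γ, γ.Nonempty) (u v : ι → ℝ) :
    |softMinMaxDeriv k Γ u v| ≤ softMinMaxDeriv k Γ u fun z => |v z| := by
  refine abs_le'.2 ⟨softMinMaxDeriv_mono hΓ hne u fun z => le_abs_self _, ?_⟩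
  rw [← softMinMaxDeriv_neg]
  exact softMinMaxDeriv_mono hΓ hne u fun z => neg_le_abs _

lemma lintegral_softMinMaxDeriv_le {μ : Measure (ι → ℝ)} (hΓ : Γ.Nonempty)
    (hne : ∀ γ ∈ Γ, γ.Nonempty) {σ : ℝ} (hint : ∀ z, Integrable (fun u => u z) μ)
    (hσ : ∀ z, ∫ u, |u z| ∂μ ≤ σ) (u : ι → ℝ) :
    ∫⁻ v, ‖softMinMaxDeriv k Γ u v‖ₑ ∂μ ≤ ENNReal.ofReal σ := by
  have hi : Integrable (fun v : ι → ℝ => softMinMaxDeriv k Γ u fun z => |v z|) μ :=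
    Integrable.div_const (integrable_finsetSum _ fun γ _ => Integrable.const_mul
      (integrable_finsetSum _ fun z _ => (hint z).abs.const_mul _) _) _
  calc ∫⁻ v, ‖softMinMaxDeriv k Γ u v‖ₑ ∂μ
      ≤ ∫⁻ v, ENNReal.ofReal (softMinMaxDeriv k Γ u fun z => |v z|) ∂μ := by
        refine lintegral_mono fun v => ?_
        rw [← ofReal_norm]
        exact ENNReal.ofReal_le_ofReal (abs_softMinMaxDeriv_le hΓ hne u v)
    _ = ENNReal.ofReal (∫ v, softMinMaxDeriv k Γ u (fun z => |v z|) ∂μ) := by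
        rw [ofReal_integral_eq_lintegral_ofReal hi]
        exact Eventually.of_forall fun v => (abs_nonneg _).trans (abs_softMinMaxDeriv_le hΓ hne u v)
    _ ≤ ENNReal.ofReal σ := by
        refine ENNReal.ofReal_le_ofReal ?_
        have : ∫ v, softMinMaxDeriv k Γ u (fun z => |v z|) ∂μ
            = softMinMaxDeriv k Γ u fun z => ∫ v, |v z| ∂μ := by
          simp only [softMinMaxDeriv]
          rw [integral_div, integral_finsetSum _ fun γ _ => Integrable.const_mul
            (integrable_finsetSum _ fun z _ => (hint z).abs.const_mul _) _]
          congr 1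
          refine Finset.sum_congr rfl fun γ _ => ?_
          rw [integral_const_mul, integral_finsetSum _ fun z _ => (hint z).abs.const_mul _]
          congr 1
          exact Finset.sum_congr rfl fun z _ => integral_const_mul _ _
        rw [this]
        exact (softMinMaxDeriv_mono hΓ hne u hσ).trans (softMinMaxDeriv_const hΓ hne u σ).le

/-- A quarter turn carries the first component of the rotated pair from `p.1` to `p.2`, and the
velocity of that component is the second component. -/
lemma softMinMax_sub_eq_integral [Fintype ι] (hk : k ≠ 0) (hΓ : Γ.Nonempty) (hne : ∀ γ ∈ Γ, γ.Nonempty)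
    (p : (ι → ℝ) × (ι → ℝ)) :
    softMinMax k Γ p.2 - softMinMax k Γ p.1 = ∫ θ in (0 : ℝ)..Real.pi / 2,
      softMinMaxDeriv k Γ (ContinuousLinearMap.rotation θ p).1
        (ContinuousLinearMap.rotation θ p).2 := by
  have hcont : Continuous fun θ : ℝ => ContinuousLinearMap.rotation θ p := by
    simp only [ContinuousLinearMap.rotation_apply]
    fun_prop
  rw [intervalIntegral.integral_eq_sub_of_hasDerivAt
    (f := fun θ => softMinMax k Γ (ContinuousLinearMap.rotation θ p).1)]
  · simp [ContinuousLinearMap.rotation_apply]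
  · intro θ _
    refine hasDerivAt_softMinMax hk hΓ hne fun z => ?_
    simp only [ContinuousLinearMap.rotation_apply, Pi.add_apply, Pi.smul_apply, smul_eq_mul]
    exact ((Real.hasDerivAt_cos θ).mul_const _).add ((Real.hasDerivAt_sin θ).mul_const _)
  · exact ((continuous_softMinMaxDeriv hΓ hne).comp hcont).intervalIntegrable _ _

/-- The Maurey–Pisier argument: `μ.prod μ` is invariant under rotations, so at each angle the
position and the velocity are independent with law `μ`. Each angle then costs at most `σ`, and there
is a quarter turn of them. -/
lemma lintegral_softMinMax_sub_le [Fintype ι] {μ : Measure (ι → ℝ)} [IsGaussian μ] (hμ : μ[id] = 0)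
    (hk : k ≠ 0) (hΓ : Γ.Nonempty) (hne : ∀ γ ∈ Γ, γ.Nonempty) {σ : ℝ}
    (hσ : ∀ z, ∫ u, |u z| ∂μ ≤ σ) :
    ∫⁻ p, ‖softMinMax k Γ p.2 - softMinMax k Γ p.1‖ₑ ∂(μ.prod μ)
      ≤ ENNReal.ofReal (Real.pi / 2) * ENNReal.ofReal σ := by
  have hint : ∀ z, Integrable (fun u : ι → ℝ => u z) μ := fun z =>
    IsGaussian.integrable_dual μ (ContinuousLinearMap.proj z)
  have hD := continuous_softMinMaxDeriv (k := k) hΓ hne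
  have hpos : (0 : ℝ) ≤ Real.pi / 2 := by positivity
  have hrot : Continuous fun q : ((ι → ℝ) × (ι → ℝ)) × ℝ =>
      ContinuousLinearMap.rotation q.2 q.1 := by
    simp only [ContinuousLinearMap.rotation_apply]
    fun_prop
  have hmeas : Measurable fun q : ((ι → ℝ) × (ι → ℝ)) × ℝ =>
      ‖softMinMaxDeriv k Γ (ContinuousLinearMap.rotation q.2 q.1).1
        (ContinuousLinearMap.rotation q.2 q.1).2‖ₑ := (hD.comp hrot).measurable.enorm
  calc ∫⁻ p, ‖softMinMax k Γ p.2 - softMinMax k Γ p.1‖ₑ ∂(μ.prod μ)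
      ≤ ∫⁻ p, (∫⁻ θ in Set.Ioc (0 : ℝ) (Real.pi / 2),
          ‖softMinMaxDeriv k Γ (ContinuousLinearMap.rotation θ p).1
            (ContinuousLinearMap.rotation θ p).2‖ₑ) ∂(μ.prod μ) := by
        refine lintegral_mono fun p => ?_
        rw [softMinMax_sub_eq_integral hk hΓ hne, intervalIntegral.integral_of_le hpos]
        exact enorm_integral_le_lintegral_enorm _
    _ = ∫⁻ θ in Set.Ioc (0 : ℝ) (Real.pi / 2), ∫⁻ p,
          ‖softMinMaxDeriv k Γ (ContinuousLinearMap.rotation θ p).1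
            (ContinuousLinearMap.rotation θ p).2‖ₑ ∂(μ.prod μ) :=
        lintegral_lintegral_swap hmeas.aemeasurable
    _ ≤ ∫⁻ _ in Set.Ioc (0 : ℝ) (Real.pi / 2), ENNReal.ofReal σ := by
        refine lintegral_mono fun θ => ?_
        calc ∫⁻ p, ‖softMinMaxDeriv k Γ (ContinuousLinearMap.rotation θ p).1
              (ContinuousLinearMap.rotation θ p).2‖ₑ ∂(μ.prod μ)
            = ∫⁻ p, ‖softMinMaxDeriv k Γ p.1 p.2‖ₑ
                ∂((μ.prod μ).map (ContinuousLinearMap.rotation θ)) := by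
              rw [lintegral_map hD.measurable.enorm (by fun_prop)]
          _ = ∫⁻ u, ∫⁻ v, ‖softMinMaxDeriv k Γ u v‖ₑ ∂μ ∂μ := by
              rw [IsGaussian.map_rotation_eq_self hμ, lintegral_prod _
                hD.measurable.enorm.aemeasurable]
          _ ≤ ∫⁻ _, ENNReal.ofReal σ ∂μ :=
              lintegral_mono fun u => lintegral_softMinMaxDeriv_le hΓ hne hint hσ u
          _ = ENNReal.ofReal σ := by simp
    _ = ENNReal.ofReal (Real.pi / 2) * ENNReal.ofReal σ := by simp [mul_comm]

lemma softMinMax_le [Fintype ι] (hk : 0 < k) (hne : ∀ γ ∈ Γ, γ.Nonempty) {u : ι → ℝ} {a : ℝ}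
    (h : ∃ γ ∈ Γ, ∀ z ∈ γ, u z ≤ a) :
    softMinMax k Γ u ≤ a + Real.log (Fintype.card ι) / k := by
  obtain ⟨γ, hγ, hu⟩ := h
  have hS := expSum_pos (k := k) (hne γ hγ) u
  have h0 : (0 : ℝ) < Fintype.card ι := by
    obtain ⟨z, _⟩ := hne γ hγ
    exact_mod_cast Fintype.card_pos_iff.2 ⟨z⟩
  have h1 : expSum k γ u ≤ Fintype.card ι * Real.exp (k * a) := by
    calc expSum k γ u ≤ ∑ z ∈ γ, Real.exp (k * a) :=
          Finset.sum_le_sum fun z hz => Real.exp_le_exp.2 (by have := hu z hz; gcongr)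
      _ = γ.card * Real.exp (k * a) := by simp
      _ ≤ _ := by
          have : (γ.card : ℝ) ≤ Fintype.card ι := by exact_mod_cast γ.card_le_univ
          gcongr
  have h2 : (expSum k γ u)⁻¹ ≤ invExpSum k Γ u :=
    Finset.single_le_sum (f := fun γ => (expSum k γ u)⁻¹)
      (fun γ hγ => (inv_pos.2 (expSum_pos (hne γ hγ) u)).le) hγ
  have h3 : -(Real.log (Fintype.card ι) + k * a) ≤ Real.log (invExpSum k Γ u) := by
    calc -(Real.log (Fintype.card ι) + k * a)
        = -Real.log (Fintype.card ι * Real.exp (k * a)) := by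
          rw [Real.log_mul h0.ne' (Real.exp_pos _).ne', Real.log_exp]
      _ ≤ -Real.log (expSum k γ u) := neg_le_neg (Real.log_le_log hS h1)
      _ = Real.log (expSum k γ u)⁻¹ := (Real.log_inv _).symm
      _ ≤ _ := Real.log_le_log (inv_pos.2 hS) h2
  calc softMinMax k Γ u = -Real.log (invExpSum k Γ u) / k := by rw [softMinMax, neg_div]
    _ ≤ (Real.log (Fintype.card ι) + k * a) / k := by gcongr; linarith
    _ = _ := by field_simp; ring

lemma le_softMinMax (hk : 0 < k) (hΓ : Γ.Nonempty) (hne : ∀ γ ∈ Γ, γ.Nonempty) {u : ι → ℝ} {b : ℝ}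
    (h : ¬∃ γ ∈ Γ, ∀ z ∈ γ, u z ≤ b) :
    b - Real.log Γ.card / k ≤ softMinMax k Γ u := by
  push Not at h
  have h0 : (0 : ℝ) < Γ.card := by exact_mod_cast hΓ.card_pos
  have h1 : invExpSum k Γ u ≤ Γ.card * Real.exp (-(k * b)) := by
    calc invExpSum k Γ u ≤ ∑ γ ∈ Γ, Real.exp (-(k * b)) := by
          refine Finset.sum_le_sum fun γ hγ => ?_
          obtain ⟨z, hz, hzb⟩ := h γ hγ
          rw [Real.exp_neg]
          refine inv_anti₀ (Real.exp_pos _) ?_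
          calc Real.exp (k * b) ≤ Real.exp (k * u z) := by gcongr
            _ ≤ expSum k γ u := Finset.single_le_sum (f := fun z => Real.exp (k * u z))
                (fun _ _ => (Real.exp_pos _).le) hz
      _ = _ := by simp
  have h2 : Real.log (invExpSum k Γ u) ≤ Real.log Γ.card - k * b := by
    calc Real.log (invExpSum k Γ u) ≤ Real.log (Γ.card * Real.exp (-(k * b))) :=
          Real.log_le_log (invExpSum_pos hΓ hne u) h1
      _ = _ := by rw [Real.log_mul h0.ne' (Real.exp_pos _).ne', Real.log_exp]; ring
  calc b - Real.log Γ.card / k = -(Real.log Γ.card - k * b) / k := by field_simp; ring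
    _ ≤ -Real.log (invExpSum k Γ u) / k := by gcongr
    _ = softMinMax k Γ u := by rw [softMinMax, neg_div]

/-- Taking `k` this large brings both smoothing errors below one; `k` does not enter the bound on
the fluctuations, so the sizes of `ι` and `Γ` disappear. -/
lemma exists_softMin_param (x y : ℝ) : ∃ k : ℝ, 0 < k ∧ x / k ≤ 1 ∧ y / k ≤ 1 := by
  refine ⟨|x| + |y| + 1, by positivity, ?_, ?_⟩
  · rw [div_le_one (by positivity)]
    linarith [le_abs_self x, abs_nonneg y]
  · rw [div_le_one (by positivity)]
    linarith [le_abs_self y, abs_nonneg x]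

/-- Concentration of the functional `u ↦ min_{γ ∈ Γ} max_{z ∈ γ} u_z` of a centered Gaussian vector
whose coordinates have `L¹` norm at most `σ`, uniformly in the dimension and in `Γ`. -/
theorem gaussian_minMax_concentration [Fintype ι] {μ : Measure (ι → ℝ)} [IsGaussian μ] (hμ : μ[id] = 0)
    (hΓ : Γ.Nonempty) (hne : ∀ γ ∈ Γ, γ.Nonempty) {σ : ℝ}
    (hσ : ∀ z, ∫ u, |u z| ∂μ ≤ σ) (a b : ℝ) :
    ENNReal.ofReal (b - a - 2) *
        (μ {u | ∃ γ ∈ Γ, ∀ z ∈ γ, u z ≤ a} * μ {u | ¬∃ γ ∈ Γ, ∀ z ∈ γ, u z ≤ b})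
      ≤ ENNReal.ofReal (Real.pi / 2) * ENNReal.ofReal σ := by
  obtain ⟨k, hk, h1, h2⟩ := exists_softMin_param (Real.log (Fintype.card ι)) (Real.log Γ.card)
  refine le_trans ?_ (lintegral_softMinMax_sub_le hμ hk.ne' hΓ hne hσ)
  rw [← Measure.prod_prod]
  have hF := continuous_softMinMax (k := k) hΓ hne
  refine le_trans ?_ (mul_meas_ge_le_lintegral (μ := μ.prod μ)
    (f := fun p : (ι → ℝ) × (ι → ℝ) => ‖softMinMax k Γ p.2 - softMinMax k Γ p.1‖ₑ)
    ((hF.comp continuous_snd).sub (hF.comp continuous_fst)).measurable.enorm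
    (ENNReal.ofReal (b - a - 2)))
  gcongr
  rintro ⟨u, v⟩ ⟨hu, hv⟩
  -- The smooth functional is at most `a + 1` at `u` and at least `b - 1` at `v`, hence the `2` in
  -- the statement.
  have hu' := softMinMax_le hk hne hu
  have hv' := le_softMinMax hk hΓ hne hv
  change _ ≤ ‖softMinMax k Γ v - softMinMax k Γ u‖ₑ
  rw [← ofReal_norm]
  refine ENNReal.ofReal_le_ofReal (le_trans ?_ (le_abs_self _))
  linarith

end SoftMin

/-! ### Crossings of the square grid -/

/-- The contribution of the edge between `x` and `y` to the flux through the boundary of a set `c`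
of the points of `k` outside of it. -/
def edgeFlux (cx kx cy ky : Bool) : ZMod 2 :=
  if cx = cy then 0 else if (if cx then ky else kx) then 1 else 0

set_option synthInstance.maxHeartbeats 400000 in
set_option synthInstance.maxSize 100000 in
-- The corners are `(i, j)`, `(i+1, j)`, `(i, j+1)`, `(i+1, j+1)`. The hypotheses make `k` constant
-- on the corners outside `c` adjacent to `c`, and membership in `c` changes an even number of times
-- around the face, so the total flux is even.
lemma edgeFlux_face : ∀ c₁ c₂ c₃ c₄ k₁ k₂ k₃ k₄ : Bool,
    ((!c₁ && (c₂ || c₃)) → (!c₂ && (c₁ || c₄)) → k₁ = k₂) →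
    ((!c₁ && (c₂ || c₃)) → (!c₃ && (c₁ || c₄)) → k₁ = k₃) →
    ((!c₁ && (c₂ || c₃)) → (!c₄ && (c₂ || c₃)) → k₁ = k₄) →
    ((!c₂ && (c₁ || c₄)) → (!c₃ && (c₁ || c₄)) → k₂ = k₃) →
    ((!c₂ && (c₁ || c₄)) → (!c₄ && (c₂ || c₃)) → k₂ = k₄) →
    ((!c₃ && (c₁ || c₄)) → (!c₄ && (c₂ || c₃)) → k₃ = k₄) →
    edgeFlux c₃ k₃ c₄ k₄ - edgeFlux c₁ k₁ c₂ k₂ = edgeFlux c₂ k₂ c₄ k₄ - edgeFlux c₁ k₁ c₃ k₃ := by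
  decide

/-- A parity obstruction: in the grid `{0, …, m} × {0, …, n}` let `c` contain the left column and
avoid the right column, let `o` contain the points which are neighbors of `c` but not in `c`, and
let `k` be a union of `*`-connected components of `o`. Then `k` cannot contain the points of `o` in
the bottom row and avoid those in the top row. -/
theorem false_of_separating {m n : ℕ} (c o k : ℕ → ℕ → Prop)
    (hleft : ∀ j, c 0 j) (hright : ∀ j, ¬c m j)
    (hR : ∀ i j, i < m → j ≤ n → c i j → ¬c (i + 1) j → o (i + 1) j)
    (hL : ∀ i j, i < m → j ≤ n → c (i + 1) j → ¬c i j → o i j)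
    (hU : ∀ i j, i ≤ m → j < n → c i j → ¬c i (j + 1) → o i (j + 1))
    (hD : ∀ i j, i ≤ m → j < n → c i (j + 1) → ¬c i j → o i j)
    (hk : ∀ i j i' j', o i j → o i' j' → i ≤ i' + 1 → i' ≤ i + 1 → j ≤ j' + 1 → j' ≤ j + 1 →
      k i j → k i' j')
    (hbot : ∀ i, o i 0 → k i 0) (htop : ∀ i, o i n → ¬k i n) : False := by
  classical
  set C : ℕ → ℕ → Bool := fun i j => decide (c i j) with hC
  set K : ℕ → ℕ → Bool := fun i j => decide (k i j) with hK
  set H : ℕ → ℕ → ZMod 2 := fun i j => edgeFlux (C i j) (K i j) (C (i + 1) j) (K (i + 1) j) with hH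
  set V : ℕ → ℕ → ZMod 2 := fun i j => edgeFlux (C i j) (K i j) (C i (j + 1)) (K i (j + 1)) with hV
  have kk : ∀ i j i' j', o i j → o i' j' → i ≤ i' + 1 → i' ≤ i + 1 → j ≤ j' + 1 → j' ≤ j + 1 →
      K i j = K i' j' := by
    intro i j i' j' h1 h2 h3 h4 h5 h6
    simp only [hK, decide_eq_decide]
    exact ⟨hk _ _ _ _ h1 h2 h3 h4 h5 h6, hk _ _ _ _ h2 h1 h4 h3 h6 h5⟩
  have face : ∀ i j, i < m → j < n → H i (j + 1) - H i j = V (i + 1) j - V i j := by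
    intro i j hi hj
    have o1 : (!C i j && (C (i + 1) j || C i (j + 1))) = true → o i j := by
      simp only [hC, Bool.and_eq_true, Bool.or_eq_true, Bool.not_eq_true', decide_eq_true_eq,
        decide_eq_false_iff_not]
      rintro ⟨h, h' | h'⟩
      · exact hL i j hi hj.le h' h
      · exact hD i j hi.le hj h' h
    have o2 : (!C (i + 1) j && (C i j || C (i + 1) (j + 1))) = true → o (i + 1) j := by
      simp only [hC, Bool.and_eq_true, Bool.or_eq_true, Bool.not_eq_true', decide_eq_true_eq,
        decide_eq_false_iff_not]
      rintro ⟨h, h' | h'⟩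
      · exact hR i j hi hj.le h' h
      · exact hD (i + 1) j hi hj h' h
    have o3 : (!C i (j + 1) && (C i j || C (i + 1) (j + 1))) = true → o i (j + 1) := by
      simp only [hC, Bool.and_eq_true, Bool.or_eq_true, Bool.not_eq_true', decide_eq_true_eq,
        decide_eq_false_iff_not]
      rintro ⟨h, h' | h'⟩
      · exact hU i j hi.le hj h' h
      · exact hL i (j + 1) hi hj h' h
    have o4 : (!C (i + 1) (j + 1) && (C (i + 1) j || C i (j + 1))) = true →
        o (i + 1) (j + 1) := by
      simp only [hC, Bool.and_eq_true, Bool.or_eq_true, Bool.not_eq_true', decide_eq_true_eq,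
        decide_eq_false_iff_not]
      rintro ⟨h, h' | h'⟩
      · exact hU (i + 1) j hi hj h' h
      · exact hR i (j + 1) hi hj h' h
    refine edgeFlux_face _ _ _ _ _ _ _ _ ?_ ?_ ?_ ?_ ?_ ?_
    · exact fun h h' => kk _ _ _ _ (o1 h) (o2 h') (by omega) (by omega) (by omega) (by omega)
    · exact fun h h' => kk _ _ _ _ (o1 h) (o3 h') (by omega) (by omega) (by omega) (by omega)
    · exact fun h h' => kk _ _ _ _ (o1 h) (o4 h') (by omega) (by omega) (by omega) (by omega)
    · exact fun h h' => kk _ _ _ _ (o2 h) (o3 h') (by omega) (by omega) (by omega) (by omega)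
    · exact fun h h' => kk _ _ _ _ (o2 h) (o4 h') (by omega) (by omega) (by omega) (by omega)
    · exact fun h h' => kk _ _ _ _ (o3 h) (o4 h') (by omega) (by omega) (by omega) (by omega)
  -- Summing over the faces of a row telescopes. The side terms vanish because the leftmost column
  -- lies in `c` and the rightmost outside it.
  have rows : ∀ j, j ≤ n → ∑ i ∈ Finset.range m, H i j = ∑ i ∈ Finset.range m, H i 0 := by
    intro j
    induction j with
    | zero => intro; rfl
    | succ j ih =>
      intro hj
      rw [← ih (by omega), ← sub_eq_zero, ← Finset.sum_sub_distrib,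
        Finset.sum_congr rfl fun i hi => face i j (Finset.mem_range.1 hi) (by omega),
        Finset.sum_range_sub (fun i => V i j)]
      simp [hV, hC, edgeFlux, hleft, hright]
  have top0 : ∑ i ∈ Finset.range m, H i n = 0 := by
    refine Finset.sum_eq_zero fun i hi => ?_
    have hi := Finset.mem_range.1 hi
    by_cases h1 : c i n <;> by_cases h2 : c (i + 1) n
    · simp [hH, hC, edgeFlux, h1, h2]
    · have := htop _ (hR i n hi le_rfl h1 h2)
      simp [hH, hC, hK, edgeFlux, h1, h2, this]
    · have := htop _ (hL i n hi le_rfl h2 h1)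
      simp [hH, hC, hK, edgeFlux, h1, h2, this]
    · simp [hH, hC, edgeFlux, h1, h2]
  -- On the bottom row every boundary edge counts, and the row starts in `c` and ends outside it, so
  -- their number is odd.
  have bot1 : ∑ i ∈ Finset.range m, H i 0 = -1 := by
    have : ∀ i ∈ Finset.range m, H i 0
        = (if c (i + 1) 0 then (1 : ZMod 2) else 0) - (if c i 0 then (1 : ZMod 2) else 0) := by
      intro i hi
      have hi := Finset.mem_range.1 hi
      by_cases h1 : c i 0 <;> by_cases h2 : c (i + 1) 0
      · simp [hH, hC, edgeFlux, h1, h2]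
      · have := hbot _ (hR i 0 hi (Nat.zero_le _) h1 h2)
        simp [hH, hC, hK, edgeFlux, h1, h2, this]
      · have := hbot _ (hL i 0 hi (Nat.zero_le _) h2 h1)
        simp [hH, hC, hK, edgeFlux, h1, h2, this]
      · simp [hH, hC, edgeFlux, h1, h2]
    rw [Finset.sum_congr rfl this,
      Finset.sum_range_sub (fun i => if c i 0 then (1 : ZMod 2) else 0)]
    simp [hleft, hright]
  have := rows n le_rfl
  rw [top0, bot1] at this
  exact absurd this (by decide)

/-! ### King-move and nearest-neighbor crossings, planar duality -/

section Grid

variable {n : ℕ}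

/-- Points of the grid at `ℓ^∞`-distance at most one. -/
def KingAdj (x y : Fin (n + 1) × Fin (n + 1)) : Prop :=
  (x.1 : ℕ) ≤ y.1 + 1 ∧ (y.1 : ℕ) ≤ x.1 + 1 ∧ (x.2 : ℕ) ≤ y.2 + 1 ∧ (y.2 : ℕ) ≤ x.2 + 1

lemma KingAdj.symm {x y : Fin (n + 1) × Fin (n + 1)} (h : KingAdj x y) : KingAdj y x :=
  ⟨h.2.1, h.1, h.2.2.2, h.2.2.1⟩

/-- The graph of king moves in a subset of the grid. -/
def kingGraph (S : Set (Fin (n + 1) × Fin (n + 1))) : SimpleGraph (Fin (n + 1) × Fin (n + 1)) where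
  Adj x y := x ≠ y ∧ KingAdj x y ∧ x ∈ S ∧ y ∈ S
  symm := ⟨fun _ _ h => ⟨h.1.symm, h.2.1.symm, h.2.2.2, h.2.2.1⟩⟩
  loopless := ⟨fun _ h => h.1 rfl⟩

/-- The graph of nearest-neighbor moves in a subset of the grid. -/
def nnGraph (S : Set (Fin (n + 1) × Fin (n + 1))) : SimpleGraph (Fin (n + 1) × Fin (n + 1)) where
  Adj x y := ((x.1 = y.1 ∧ ((x.2 : ℕ) + 1 = y.2 ∨ (y.2 : ℕ) + 1 = x.2)) ∨
    (x.2 = y.2 ∧ ((x.1 : ℕ) + 1 = y.1 ∨ (y.1 : ℕ) + 1 = x.1))) ∧ x ∈ S ∧ y ∈ S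
  symm := ⟨fun _ _ h => ⟨h.1.imp (fun h => ⟨h.1.symm, h.2.symm⟩) (fun h => ⟨h.1.symm, h.2.symm⟩),
    h.2.2, h.2.1⟩⟩
  loopless := ⟨fun _ h => by omega⟩

/-- `x` is joined to the left side by king moves in `S`. -/
def JoinedLeft (S : Set (Fin (n + 1) × Fin (n + 1))) (x : Fin (n + 1) × Fin (n + 1)) : Prop :=
  ∃ a, a ∈ S ∧ a.1 = 0 ∧ (kingGraph S).Reachable a x

/-- `S` contains a left-right crossing of the grid by king moves. -/
def HasCrossing (S : Set (Fin (n + 1) × Fin (n + 1))) : Prop :=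
  ∃ b, b.1 = Fin.last n ∧ JoinedLeft S b

lemma kingGraph_mono {S S' : Set (Fin (n + 1) × Fin (n + 1))} (h : S ⊆ S') :
    kingGraph S ≤ kingGraph S' := fun _ _ h' => ⟨h'.1, h'.2.1, h h'.2.2.1, h h'.2.2.2⟩

lemma HasCrossing.mono {S S' : Set (Fin (n + 1) × Fin (n + 1))} (h : S ⊆ S')
    (hS : HasCrossing S) : HasCrossing S' := by
  obtain ⟨b, hb, a, ha, ha0, hab⟩ := hS
  exact ⟨b, hb, a, h ha, ha0, hab.mono (kingGraph_mono h)⟩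

lemma JoinedLeft.mem {S : Set (Fin (n + 1) × Fin (n + 1))} {x : Fin (n + 1) × Fin (n + 1)}
    (h : JoinedLeft S x) : x ∈ S := by
  obtain ⟨a, ha, -, hax⟩ := h
  rw [SimpleGraph.reachable_iff_reflTransGen] at hax
  induction hax with
  | refl => exact ha
  | tail _ h _ => exact h.2.2.2

lemma JoinedLeft.step {S : Set (Fin (n + 1) × Fin (n + 1))} {x y : Fin (n + 1) × Fin (n + 1)}
    (h : JoinedLeft S x) (hxy : KingAdj x y) (hy : y ∈ S) : JoinedLeft S y := by
  have hx := h.mem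
  obtain ⟨a, ha, ha0, hax⟩ := h
  by_cases hne : x = y
  · exact hne ▸ ⟨a, ha, ha0, hax⟩
  · have hadj : (kingGraph S).Adj x y := ⟨hne, hxy, hx, hy⟩
    exact ⟨a, ha, ha0, hax.trans hadj.reachable⟩

lemma joinedLeft_of_fst_eq_zero {S : Set (Fin (n + 1) × Fin (n + 1))}
    {x : Fin (n + 1) × Fin (n + 1)} (hx : x ∈ S) (h0 : x.1 = 0) : JoinedLeft S x :=
  ⟨x, hx, h0, SimpleGraph.Reachable.refl x⟩

/-- Planar duality: a set or the reflected complement contains a left-right crossing. -/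
theorem hasCrossing_or (S : Set (Fin (n + 1) × Fin (n + 1))) :
    HasCrossing S ∨ HasCrossing {x | x.swap ∉ S} := by
  by_contra hcon
  push Not at hcon
  obtain ⟨hS, hS'⟩ := hcon
  -- A column lying entirely in `c` is added on the left, so grid points move one step to the right.
  -- The set `c` is completed by the cluster of the left side in `S`, `o` is the complement of `S`,
  -- and `k` is the cluster of the bottom side in `o`, expressed through coordinate swaps.
  refine false_of_separating (m := n + 1) (n := n)
    (fun i j => i = 0 ∨ ∃ x, JoinedLeft S x ∧ (x.1 : ℕ) + 1 = i ∧ (x.2 : ℕ) = j)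
    (fun i j => ∃ x : Fin (n + 1) × Fin (n + 1), x ∉ S ∧ (x.1 : ℕ) + 1 = i ∧ (x.2 : ℕ) = j)
    (fun i j => ∃ x, JoinedLeft {x | x.swap ∉ S} x ∧ (x.2 : ℕ) + 1 = i ∧ (x.1 : ℕ) = j)
    (fun j => Or.inl rfl) ?_ ?_ ?_ ?_ ?_ ?_ ?_ ?_
  · rintro j (h | ⟨x, hx, h1, h2⟩)
    · omega
    · exact hS ⟨x, Fin.ext (by simpa using h1), hx⟩
  · intro i j hi hj hc hc'
    refine ⟨(⟨i, hi⟩, ⟨j, by omega⟩), fun hmem => hc' (Or.inr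
      ⟨(⟨i, hi⟩, ⟨j, by omega⟩), ?_, rfl, rfl⟩), rfl, rfl⟩
    rcases hc with rfl | ⟨x, hx, h1, h2⟩
    · exact joinedLeft_of_fst_eq_zero hmem rfl
    · exact hx.step (by simp only [KingAdj]; omega) hmem
  · intro i j hi hj hc hc'
    obtain ⟨i, rfl⟩ : ∃ i', i = i' + 1 := Nat.exists_eq_succ_of_ne_zero fun h => hc' (Or.inl h)
    refine ⟨(⟨i, by omega⟩, ⟨j, by omega⟩), fun hmem => hc' (Or.inr
      ⟨(⟨i, by omega⟩, ⟨j, by omega⟩), ?_, rfl, rfl⟩), rfl, rfl⟩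
    rcases hc with h | ⟨x, hx, h1, h2⟩
    · omega
    · exact hx.step (by simp only [KingAdj]; omega) hmem
  · intro i j hi hj hc hc'
    obtain ⟨i, rfl⟩ : ∃ i', i = i' + 1 := Nat.exists_eq_succ_of_ne_zero fun h => hc' (Or.inl h)
    refine ⟨(⟨i, by omega⟩, ⟨j + 1, by omega⟩), fun hmem => hc' (Or.inr
      ⟨(⟨i, by omega⟩, ⟨j + 1, by omega⟩), ?_, rfl, rfl⟩), rfl, rfl⟩
    rcases hc with h | ⟨x, hx, h1, h2⟩
    · omega
    · exact hx.step (by simp only [KingAdj]; omega) hmem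
  · intro i j hi hj hc hc'
    obtain ⟨i, rfl⟩ : ∃ i', i = i' + 1 := Nat.exists_eq_succ_of_ne_zero fun h => hc' (Or.inl h)
    refine ⟨(⟨i, by omega⟩, ⟨j, by omega⟩), fun hmem => hc' (Or.inr
      ⟨(⟨i, by omega⟩, ⟨j, by omega⟩), ?_, rfl, rfl⟩), rfl, rfl⟩
    rcases hc with h | ⟨x, hx, h1, h2⟩
    · omega
    · exact hx.step (by simp only [KingAdj]; omega) hmem
  · rintro i j i' j' - ⟨y, hy, hy1, hy2⟩ h1 h2 h3 h4 ⟨x, hx, hx1, hx2⟩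
    refine ⟨y.swap, hx.step ?_ (by simpa using hy), by simpa using hy1, by simpa using hy2⟩
    simp only [KingAdj, Prod.fst_swap, Prod.snd_swap]
    omega
  · rintro i ⟨y, hy, hy1, hy2⟩
    refine ⟨y.swap, joinedLeft_of_fst_eq_zero (by simpa using hy) ?_, by simpa using hy1,
      by simpa using hy2⟩
    exact Fin.ext (by simpa using hy2)
  · rintro i - ⟨x, hx, -, hx2⟩
    exact hS' ⟨x, Fin.ext (by simpa using hx2), hx⟩

lemma hasCrossing_univ : HasCrossing (Set.univ : Set (Fin (n + 1) × Fin (n + 1))) := by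
  refine (hasCrossing_or Set.univ).resolve_right ?_
  rintro ⟨b, -, a, ha, -⟩
  simp at ha

/-- A crossing by king moves in `S` gives a nearest-neighbor crossing in the neighborhood of `S`. -/
lemma HasCrossing.exists_reachable {S S' : Set (Fin (n + 1) × Fin (n + 1))} (hS : HasCrossing S)
    (hSS' : ∀ x ∈ S, ∀ y, KingAdj x y → y ∈ S') :
    ∃ a b, a ∈ S' ∧ a.1 = 0 ∧ b.1 = Fin.last n ∧ (nnGraph S').Reachable a b := by
  obtain ⟨b, hb, a, ha, ha0, hab⟩ := hS
  refine ⟨a, b, hSS' a ha a (by simp [KingAdj]), ha0, hb, ?_⟩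
  have hstep : ∀ x y, (nnGraph S').Adj x y ∨ x = y → (nnGraph S').Reachable x y := by
    rintro x y (h | rfl)
    · exact h.reachable
    · exact SimpleGraph.Reachable.refl x
  have hking : ∀ x y, (kingGraph S).Adj x y → (nnGraph S').Reachable x y := by
    rintro x y ⟨-, h, hx, hy⟩
    have hx' : x ∈ S' := hSS' x hx x (by simp [KingAdj])
    have hy' : y ∈ S' := hSS' y hy y (by simp [KingAdj])
    -- A diagonal move is replaced by two moves through this corner, itself a king neighbor of `x`.
    have hz' : (x.1, y.2) ∈ S' := hSS' x hx _ (by simp only [KingAdj] at h ⊢; omega)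
    refine (hstep x (x.1, y.2) ?_).trans (hstep (x.1, y.2) y ?_)
    · by_cases h2 : x.2 = y.2
      · exact Or.inr (Prod.ext rfl h2)
      · refine Or.inl ⟨Or.inl ⟨rfl, ?_⟩, hx', hz'⟩
        simp only [KingAdj, Fin.ext_iff] at h h2 ⊢
        omega
    · by_cases h1 : x.1 = y.1
      · exact Or.inr (Prod.ext h1 rfl)
      · refine Or.inl ⟨Or.inr ⟨rfl, ?_⟩, hz', hy'⟩
        simp only [KingAdj, Fin.ext_iff] at h h1 ⊢
        omega
  clear hb
  rw [SimpleGraph.reachable_iff_reflTransGen] at hab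
  induction hab with
  | refl => exact SimpleGraph.Reachable.refl a
  | tail _ h ih => exact ih.trans (hking _ _ h)

lemma exists_path_of_reachable {S : Set (Fin (n + 1) × Fin (n + 1))}
    {a b : Fin (n + 1) × Fin (n + 1)} (ha : a ∈ S) (hab : (nnGraph S).Reachable a b) :
    ∃ (N : ℕ) (p : Fin (N + 1) → Fin (n + 1) × Fin (n + 1)), N + 1 ≤ (n + 1) ^ 2 ∧
      p 0 = a ∧ p (Fin.last N) = b ∧ (∀ j, p j ∈ S) ∧
      ∀ j : Fin N, (nnGraph S).Adj (p j.castSucc) (p j.succ) := by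
  obtain ⟨w, hw⟩ := hab.exists_isPath
  have hadj : ∀ j : Fin w.length,
      (nnGraph S).Adj (w.getVert (j.castSucc : Fin (w.length + 1)))
        (w.getVert (j.succ : Fin (w.length + 1))) := fun j => by
    simpa using w.adj_getVert_succ j.2
  refine ⟨w.length, fun j => w.getVert j, ?_, by simp, by simp, ?_, hadj⟩
  · have := hw.length_lt
    simp only [Fintype.card_prod, Fintype.card_fin] at this
    rw [sq]
    omega
  · intro j
    refine Fin.cases (by simpa using ha) (fun i => (hadj i).2.2) j

/-- Ensures that the infimum defining `vertexDist` is over a nonempty set; the value `sInf ∅ = 0`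
would defeat lower bounds. -/
lemma reachable_univ (x y : Fin (n + 1) × Fin (n + 1)) :
    (nnGraph (Set.univ : Set (Fin (n + 1) × Fin (n + 1)))).Reachable x y := by
  have hzero : ∀ (m : ℕ) (x : Fin (n + 1) × Fin (n + 1)), (x.1 : ℕ) + x.2 = m →
      (nnGraph (Set.univ : Set (Fin (n + 1) × Fin (n + 1)))).Reachable x (0, 0) := by
    intro m
    induction m with
    | zero =>
      intro x hx
      have : x = (0, 0) := Prod.ext (Fin.ext (by simpa using (by omega : (x.1 : ℕ) = 0)))
        (Fin.ext (by simpa using (by omega : (x.2 : ℕ) = 0)))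
      rw [this]
    | succ m ih =>
      rintro ⟨⟨i, hi⟩, ⟨j, hj⟩⟩ hx
      simp only at hx
      rcases Nat.eq_zero_or_pos i with rfl | hi0
      · have hadj : (nnGraph (Set.univ : Set (Fin (n + 1) × Fin (n + 1)))).Adj
            (⟨0, hi⟩, ⟨j, hj⟩) (⟨0, hi⟩, ⟨j - 1, by omega⟩) :=
          ⟨Or.inl ⟨rfl, Or.inr (by simp; omega)⟩, trivial, trivial⟩
        exact hadj.reachable.trans (ih _ (by simp; omega))
      · have hadj : (nnGraph (Set.univ : Set (Fin (n + 1) × Fin (n + 1)))).Adj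
            (⟨i, hi⟩, ⟨j, hj⟩) (⟨i - 1, by omega⟩, ⟨j, hj⟩) :=
          ⟨Or.inr ⟨rfl, Or.inr (by simp; omega)⟩, trivial, trivial⟩
        exact hadj.reachable.trans (ih _ (by simp; omega))
  exact (hzero _ x rfl).trans (hzero _ y rfl).symm

end Grid

/-! ### Centered Gaussian vectors -/

section Gaussian

variable {Ω : Type*} [MeasurableSpace Ω] {P : Measure Ω}

/-- The law of a centered Gaussian vector is determined by its covariances. -/
lemma map_eq_map_of_covariance_eq {ι : Type*} [Fintype ι] {X Y : ι → Ω → ℝ}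
    (hX : HasGaussianLaw (fun ω i => X i ω) P) (hY : HasGaussianLaw (fun ω i => Y i ω) P)
    (hX0 : ∀ i, ∫ ω, X i ω ∂P = 0) (hY0 : ∀ i, ∫ ω, Y i ω ∂P = 0)
    (hcov : ∀ i j, covariance (X i) (X j) P = covariance (Y i) (Y j) P) :
    P.map (fun ω i => X i ω) = P.map (fun ω i => Y i ω) := by
  classical
  have := hX.isProbabilityMeasure
  have := P.isFiniteMeasure_map (fun ω i => X i ω)
  have := P.isFiniteMeasure_map (fun ω i => Y i ω)
  have key : ∀ {Z : ι → Ω → ℝ}, HasGaussianLaw (fun ω i => Z i ω) P → (∀ i, ∫ ω, Z i ω ∂P = 0) →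
      ∀ L : StrongDual ℝ (ι → ℝ), (∫ ω, L (fun i => Z i ω) ∂P) = 0 ∧
        variance (fun ω => L fun i => Z i ω) P
          = ∑ i, ∑ j, L (Pi.single i 1) * (L (Pi.single j 1) * covariance (Z i) (Z j) P) := by
    intro Z hZ hZ0 L
    have hL : (fun ω => L fun i => Z i ω) = fun ω => ∑ i, L (Pi.single i 1) * Z i ω := by
      funext ω
      conv_lhs => rw [← Finset.univ_sum_single (fun i => Z i ω), map_sum]
      refine Finset.sum_congr rfl fun i _ => ?_
      rw [mul_comm, ← smul_eq_mul, ← map_smul]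
      congr 1
      ext j
      by_cases h : j = i
      · subst h; simp
      · simp [h]
    have hmem : ∀ i, MemLp (Z i) 2 P := fun i => (hZ.eval i).memLp_two
    constructor
    · rw [hL, integral_finsetSum _ fun i _ => ((hZ.eval i).integrable.const_mul _)]
      simp [integral_const_mul, hZ0]
    · rw [hL, ← covariance_self (by
        refine Finset.aemeasurable_fun_sum _ fun i _ => (hmem i).aemeasurable.const_mul _),
        covariance_fun_sum_fun_sum (fun i => (hmem i).const_mul _) fun i => (hmem i).const_mul _]
      simp only [covariance_const_mul_left, covariance_const_mul_right]
      exact Finset.sum_congr rfl fun i _ => Finset.sum_congr rfl fun j _ => by ring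
  refine Measure.ext_of_charFunDual (funext fun L => ?_)
  rw [hX.charFunDual_map_eq, hY.charFunDual_map_eq]
  simp only [Function.comp_def]
  rw [(key hX hX0 L).1, (key hX hX0 L).2, (key hY hY0 L).1, (key hY hY0 L).2]
  simp [hcov]

lemma integrable_exp_mul_of_hasGaussianLaw {X : Ω → ℝ} (hX : HasGaussianLaw X P) (t : ℝ) :
    Integrable (fun ω => Real.exp (t * X ω)) P := by
  have h := integrable_exp_mul_gaussianReal (μ := P[X]) (v := Var[X; P].toNNReal) t
  rw [← hX.map_eq_gaussianReal] at h
  exact (integrable_map_measure h.1 hX.aemeasurable).1 h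

lemma integral_exp_mul_le {X : Ω → ℝ} (hX : HasGaussianLaw X P) (hX0 : ∫ ω, X ω ∂P = 0) {v : ℝ}
    (hv : variance X P ≤ v) (t : ℝ) :
    ∫ ω, Real.exp (t * X ω) ∂P ≤ Real.exp (v * t ^ 2 / 2) := by
  have h := mgf_gaussianReal hX.map_eq_gaussianReal t
  rw [mgf, hX0, zero_mul, zero_add, Real.coe_toNNReal _ (variance_nonneg X P)] at h
  rw [h]
  gcongr

lemma lintegral_exp_mul_le {X : Ω → ℝ} (hX : HasGaussianLaw X P) (hX0 : ∫ ω, X ω ∂P = 0) {v : ℝ}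
    (hv : variance X P ≤ v) (t : ℝ) :
    ∫⁻ ω, ENNReal.ofReal (Real.exp (t * X ω)) ∂P ≤ ENNReal.ofReal (Real.exp (v * t ^ 2 / 2)) := by
  rw [← ofReal_integral_eq_lintegral_ofReal (integrable_exp_mul_of_hasGaussianLaw hX t)
    (Eventually.of_forall fun ω => (Real.exp_pos _).le)]
  exact ENNReal.ofReal_le_ofReal (integral_exp_mul_le hX hX0 hv t)

lemma measure_lt_le_exp {X : Ω → ℝ} (hX : HasGaussianLaw X P) (hX0 : ∫ ω, X ω ∂P = 0) {v : ℝ}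
    (hv : variance X P ≤ v) {t : ℝ} (ht : 0 ≤ t) (a : ℝ) :
    P {ω | a < X ω} ≤ ENNReal.ofReal (Real.exp (v * t ^ 2 / 2 - t * a)) := by
  have hpos : ENNReal.ofReal (Real.exp (t * a)) ≠ 0 := by simp [Real.exp_pos]
  have h1 : ENNReal.ofReal (Real.exp (t * a)) * P {ω | a < X ω}
      ≤ ENNReal.ofReal (Real.exp (v * t ^ 2 / 2)) := by
    refine le_trans ?_ (lintegral_exp_mul_le hX hX0 hv t)
    refine le_trans ?_ (mul_meas_ge_le_lintegral₀
      (integrable_exp_mul_of_hasGaussianLaw hX t).1.aemeasurable.ennreal_ofReal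
      (ENNReal.ofReal (Real.exp (t * a))))
    gcongr with ω
    intro hω
    exact ENNReal.ofReal_le_ofReal (Real.exp_le_exp.2 (mul_le_mul_of_nonneg_left hω.le ht))
  rw [Real.exp_sub, ENNReal.ofReal_div_of_pos (Real.exp_pos _),
    ENNReal.le_div_iff_mul_le (Or.inl hpos) (Or.inl ENNReal.ofReal_ne_top), mul_comm]
  exact h1

lemma integral_abs_le_sqrt {X : Ω → ℝ} (hX : HasGaussianLaw X P) (hX0 : ∫ ω, X ω ∂P = 0) {v : ℝ}
    (hv0 : 0 < v) (hv : variance X P ≤ v) : ∫ ω, |X ω| ∂P ≤ Real.sqrt v := by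
  have := hX.isProbabilityMeasure
  have hs := Real.sqrt_pos.2 hv0
  have hi2 : Integrable (fun ω => X ω ^ 2) P := hX.memLp_two.integrable_sq
  have h2 : ∫ ω, X ω ^ 2 ∂P ≤ v := by
    rwa [variance_of_integral_eq_zero hX.aemeasurable hX0] at hv
  calc ∫ ω, |X ω| ∂P ≤ ∫ ω, (X ω ^ 2 * (2 * Real.sqrt v)⁻¹ + Real.sqrt v / 2) ∂P := by
        refine integral_mono hX.integrable.abs ((hi2.mul_const _).add (integrable_const _))
          fun ω => ?_
        have h : 0 ≤ (|X ω| - Real.sqrt v) ^ 2 * (2 * Real.sqrt v)⁻¹ := by positivity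
        have h' : (|X ω| - Real.sqrt v) ^ 2 * (2 * Real.sqrt v)⁻¹
            = X ω ^ 2 * (2 * Real.sqrt v)⁻¹ + Real.sqrt v / 2 - |X ω| := by
          rw [sub_sq, sq_abs]
          field_simp
          ring
        change |X ω| ≤ X ω ^ 2 * (2 * Real.sqrt v)⁻¹ + Real.sqrt v / 2
        linarith
    _ = (∫ ω, X ω ^ 2 ∂P) * (2 * Real.sqrt v)⁻¹ + Real.sqrt v / 2 := by
        rw [integral_add (hi2.mul_const _) (integrable_const _), integral_mul_const]
        simp
    _ ≤ v * (2 * Real.sqrt v)⁻¹ + Real.sqrt v / 2 := by gcongr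
    _ = Real.sqrt v := by
        have : v = Real.sqrt v * Real.sqrt v := (Real.mul_self_sqrt hv0.le).symm
        nth_rewrite 1 [this]
        field_simp
        ring

end Gaussian

/-! ### The circle averages as a Gaussian vector -/

section GFF

variable {Ω : Type*} [MeasurableSpace Ω] {P : Measure Ω} {h : Measure ℂ → Ω → ℝ}

lemma IsWholePlaneGFF.hasGaussianLaw_circleAvg (hGFF : IsWholePlaneGFF h P) {ε : ℝ} (hε : 0 < ε)
    {ι : Type*} [Fintype ι] (f : ι → ℂ) :
    HasGaussianLaw (fun ω i => circleAvg h ε (f i) ω) P := by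
  have h1 := (hGFF.gaussian.comp_right fun i : ι =>
    (⟨circleMeasure (f i) ε, hasFiniteLogEnergy_circleMeasure (f i) hε⟩ :
      {μ : Measure ℂ // HasFiniteLogEnergy μ})).hasGaussianLaw Finset.univ
  exact h1.map_fun (ContinuousLinearMap.pi fun i : ι =>
    ContinuousLinearMap.proj (R := ℝ) (φ := fun _ : (Finset.univ : Finset ι) => ℝ)
      ⟨i, Finset.mem_univ i⟩)

lemma IsWholePlaneGFF.hasGaussianLaw_circleAvg_single (hGFF : IsWholePlaneGFF h P) {ε : ℝ}
    (hε : 0 < ε) (z : ℂ) : HasGaussianLaw (circleAvg h ε z) P :=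
  (hGFF.hasGaussianLaw_circleAvg hε fun _ : Unit => z).eval ()

lemma IsWholePlaneGFF.integral_circleAvg (hGFF : IsWholePlaneGFF h P) {ε : ℝ} (hε : 0 < ε)
    (z : ℂ) : ∫ ω, circleAvg h ε z ω ∂P = 0 :=
  hGFF.centered _ (hasFiniteLogEnergy_circleMeasure z hε)

lemma IsWholePlaneGFF.covariance_circleAvg (hGFF : IsWholePlaneGFF h P) {ε : ℝ} (hε : 0 < ε)
    (z w : ℂ) : covariance (circleAvg h ε z) (circleAvg h ε w) P = circleCov ε z w := by
  rw [← integral_greenKernel_circleMeasure z w hε]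
  exact hGFF.covariance_eq _ _ (hasFiniteLogEnergy_circleMeasure z hε)
    (hasFiniteLogEnergy_circleMeasure w hε)

lemma posLog_three_le : Real.posLog 3 ≤ 2 := by
  rw [Real.posLog_eq_log_max_one (by norm_num)]
  have := Real.log_le_sub_one_of_pos (x := 3) (by norm_num)
  rw [max_eq_right (by norm_num : (1 : ℝ) ≤ 3)]
  linarith

lemma IsWholePlaneGFF.variance_circleAvg_le (hGFF : IsWholePlaneGFF h P) {ε : ℝ} (hε : 0 < ε)
    {z : ℂ} (hz : ‖z‖ + ε ≤ 3) : variance (circleAvg h ε z) P ≤ -Real.log ε + 4 := by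
  rw [← covariance_self (hGFF.hasGaussianLaw_circleAvg_single hε z).aemeasurable,
    hGFF.covariance_circleAvg hε, circleCov, avgPosLogSub_self hε]
  linarith [avgPosLog_le hε hz, posLog_three_le]

/-- All terms cancel except `2 * avgPosLogSub ε z w ≤ 2 log 3`, so the bound is uniform in `ε`. -/
lemma IsWholePlaneGFF.variance_circleAvg_sub_le (hGFF : IsWholePlaneGFF h P) {ε : ℝ} (hε : 0 < ε)
    {z w : ℂ} (hzw : ‖z - w‖ ≤ 2 * ε) :
    variance (fun ω => circleAvg h ε z ω - circleAvg h ε w ω) P ≤ 4 := by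
  have hz := hGFF.hasGaussianLaw_circleAvg_single hε z
  have hw := hGFF.hasGaussianLaw_circleAvg_single hε w
  have := hz.isProbabilityMeasure
  rw [variance_fun_sub hz.memLp_two hw.memLp_two, ← covariance_self hz.aemeasurable,
    ← covariance_self hw.aemeasurable, hGFF.covariance_circleAvg hε, hGFF.covariance_circleAvg hε,
    hGFF.covariance_circleAvg hε]
  simp only [circleCov, avgPosLogSub_self hε]
  have h1 := avgPosLogSub_le (r := 2) hε hzw
  norm_num at h1
  linarith [posLog_three_le]

end GFF

/-! ### The lattice as a grid -/

/-- The integer `n` such that `𝕊^ε` consists of `(n + 1)²` points. -/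
def meshSize (ε : ℝ) : ℕ := ⌊1 / ε⌋₊

/-- The index set of the vertices of `𝕊^ε`. -/
abbrev Grid (ε : ℝ) : Type := Fin (meshSize ε + 1) × Fin (meshSize ε + 1)

/-- The vertex of `𝕊^ε` with given integer coordinates. -/
def gridPoint (ε : ℝ) (x : Grid ε) : ℂ := ⟨ε * (x.1 : ℕ), ε * (x.2 : ℕ)⟩

section Lattice

variable {ε : ℝ}

lemma mul_meshSize_le (hε : 0 < ε) {i : ℕ} (hi : i ≤ meshSize ε) : ε * i ≤ 1 := by
  have h1 : (i : ℝ) ≤ 1 / ε :=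
    le_trans (by exact_mod_cast hi) (Nat.floor_le (by positivity))
  calc ε * i ≤ ε * (1 / ε) := by gcongr
    _ = 1 := by field_simp

lemma one_lt_mul_meshSize_add_one (hε : 0 < ε) : 1 < ε * (meshSize ε + 1) := by
  have h1 : 1 / ε < meshSize ε + 1 := Nat.lt_floor_add_one (1 / ε)
  calc 1 = ε * (1 / ε) := by field_simp
    _ < ε * (meshSize ε + 1) := by gcongr

lemma meshSize_add_one_le (hε : 0 < ε) (hε1 : ε ≤ 1) : (meshSize ε + 1 : ℝ) ≤ 2 / ε := by
  have h1 : (meshSize ε : ℝ) ≤ 1 / ε := Nat.floor_le (by positivity)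
  have h2 : 1 ≤ 1 / ε := by rwa [le_div_iff₀ hε, one_mul]
  calc (meshSize ε + 1 : ℝ) ≤ 1 / ε + 1 / ε := by linarith
    _ = 2 / ε := by ring

lemma card_grid_le (hε : 0 < ε) (hε1 : ε ≤ 1) : ((meshSize ε + 1 : ℝ)) ^ 2 ≤ 4 * ε ^ (-2 : ℝ) := by
  have h := meshSize_add_one_le hε hε1
  calc ((meshSize ε + 1 : ℝ)) ^ 2 ≤ (2 / ε) ^ 2 := by gcongr
    _ = 4 * ε ^ (-2 : ℝ) := by
      rw [Real.rpow_neg hε.le, show (2 : ℝ) = ((2 : ℕ) : ℝ) by norm_num, Real.rpow_natCast]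
      field_simp
      norm_num

lemma gridPoint_mem_lattice (hε : 0 < ε) (x : Grid ε) : gridPoint ε x ∈ lattice ε := by
  refine ⟨⟨(x.1 : ℕ), (x.2 : ℕ), by simp [gridPoint]⟩, ⟨?_, ?_⟩, ⟨?_, ?_⟩⟩
  · simp only [gridPoint]; positivity
  · exact mul_meshSize_le hε (Nat.lt_succ_iff.1 x.1.2)
  · simp only [gridPoint]; positivity
  · exact mul_meshSize_le hε (Nat.lt_succ_iff.1 x.2.2)

lemma exists_nat_eq_of_mem_Icc (hε : 0 < ε) {m : ℤ} (h : ε * m ∈ Set.Icc (0 : ℝ) 1) :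
    ∃ i : Fin (meshSize ε + 1), ((i : ℕ) : ℤ) = m := by
  have h0 : (0 : ℝ) ≤ m := nonneg_of_mul_nonneg_right h.1 hε
  have h0' : 0 ≤ m := by exact_mod_cast h0
  obtain ⟨i, rfl⟩ := Int.eq_ofNat_of_zero_le h0'
  have h1 : (i : ℝ) ≤ 1 / ε := by
    rw [le_div_iff₀ hε, mul_comm]
    exact_mod_cast h.2
  exact ⟨⟨i, Nat.lt_succ_iff.2 (Nat.le_floor h1)⟩, rfl⟩

lemma exists_gridPoint_eq (hε : 0 < ε) {z : ℂ} (hz : z ∈ lattice ε) :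
    ∃ x : Grid ε, gridPoint ε x = z := by
  obtain ⟨⟨m, n, rfl⟩, hre, him⟩ := hz
  obtain ⟨i, rfl⟩ := exists_nat_eq_of_mem_Icc hε hre
  obtain ⟨j, rfl⟩ := exists_nat_eq_of_mem_Icc hε him
  exact ⟨(i, j), by simp [gridPoint]⟩

lemma gridPoint_mem_leftBoundary (hε : 0 < ε) {x : Grid ε} (hx : x.1 = 0) :
    gridPoint ε x ∈ leftBoundary ε := by
  refine ⟨gridPoint_mem_lattice hε x, fun h => ?_⟩
  have := h.2.1.1
  simp [gridPoint, hx] at this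
  linarith

lemma gridPoint_mem_rightBoundary (hε : 0 < ε) {x : Grid ε} (hx : x.1 = Fin.last _) :
    gridPoint ε x ∈ rightBoundary ε := by
  refine ⟨gridPoint_mem_lattice hε x, fun h => ?_⟩
  have := h.2.1.2
  simp [gridPoint, hx] at this
  linarith [one_lt_mul_meshSize_add_one hε]

lemma norm_gridPoint_le (hε : 0 < ε) (hε1 : ε ≤ 1) (x : Grid ε) : ‖gridPoint ε x‖ + ε ≤ 3 := by
  have h := gridPoint_mem_lattice hε x
  have h1 := Complex.norm_le_abs_re_add_abs_im (gridPoint ε x)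
  rw [abs_of_nonneg h.2.1.1, abs_of_nonneg h.2.2.1] at h1
  linarith [h.2.1.2, h.2.2.2]

lemma norm_gridPoint_sub_le (hε : 0 < ε) {x y : Grid ε} (h : KingAdj x y) :
    ‖gridPoint ε x - gridPoint ε y‖ ≤ 2 * ε := by
  have key : ∀ i j : ℕ, i ≤ j + 1 → j ≤ i + 1 → |ε * i - ε * j| ≤ ε := by
    intro i j h1 h2
    have h1' : (i : ℝ) ≤ j + 1 := by exact_mod_cast h1
    have h2' : (j : ℝ) ≤ i + 1 := by exact_mod_cast h2
    rw [← mul_sub, abs_mul, abs_of_pos hε]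
    exact mul_le_of_le_one_right hε.le (abs_le.2 ⟨by linarith, by linarith⟩)
  refine (Complex.norm_le_abs_re_add_abs_im _).trans ?_
  have h1 := key _ _ h.1 h.2.1
  have h2 := key _ _ h.2.2.1 h.2.2.2
  simp only [gridPoint, Complex.sub_re, Complex.sub_im]
  linarith

lemma norm_gridPoint_sub_of_adj (hε : 0 < ε) {S : Set (Grid ε)} {x y : Grid ε}
    (h : (nnGraph S).Adj x y) : ‖gridPoint ε y - gridPoint ε x‖ = ε := by
  have key : ∀ i j : ℕ, i + 1 = j ∨ j + 1 = i → |ε * j - ε * i| = ε := by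
    rintro i j (rfl | rfl)
    · push_cast
      rw [show ε * ((i : ℝ) + 1) - ε * i = ε by ring, abs_of_pos hε]
    · push_cast
      rw [show ε * (j : ℝ) - ε * ((j : ℝ) + 1) = -ε by ring, abs_neg, abs_of_pos hε]
  rcases h.1 with ⟨h1, h2⟩ | ⟨h1, h2⟩
  · have : gridPoint ε y - gridPoint ε x = Complex.I * ((ε * (y.2 : ℕ) - ε * (x.2 : ℕ) : ℝ) : ℂ) := by
      apply Complex.ext <;> simp [gridPoint, h1]
    rw [this, norm_mul, Complex.norm_real, Complex.norm_I, Real.norm_eq_abs, one_mul, key _ _ h2]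
  · have : gridPoint ε y - gridPoint ε x = ((ε * (y.1 : ℕ) - ε * (x.1 : ℕ) : ℝ) : ℂ) := by
      apply Complex.ext <;> simp [gridPoint, h1]
    rw [this, Complex.norm_real, Real.norm_eq_abs, key _ _ h2]

lemma reflect_gridPoint (x : Grid ε) : reflect (gridPoint ε x) = gridPoint ε x.swap := by
  apply Complex.ext <;> simp [reflect, gridPoint]

lemma isLatticePath_of_nnGraph (hε : 0 < ε) {S : Set (Grid ε)} {N : ℕ} {p : Fin (N + 1) → Grid ε}
    (hp : ∀ j : Fin N, (nnGraph S).Adj (p j.castSucc) (p j.succ)) :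
    IsLatticePath ε fun j => gridPoint ε (p j) :=
  ⟨fun _ => gridPoint_mem_lattice hε _, fun j => norm_gridPoint_sub_of_adj hε (hp j)⟩

end Lattice

/-! ### Events of high probability -/

lemma eventually_small {a : ℝ} (ha : 0 < a) : ∀ᶠ ε in 𝓝[>] (0 : ℝ), 0 < ε ∧ ε < a :=
  Ioo_mem_nhdsGT ha

lemma tendsto_const_mul_rpow (K : ℝ) {η : ℝ} (hη : 0 < η) :
    Tendsto (fun ε : ℝ => K * ε ^ η) (𝓝[>] 0) (𝓝 0) := by
  have h := (Real.continuousAt_rpow_const 0 η (Or.inr hη.le)).tendsto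
  rw [Real.zero_rpow hη.ne'] at h
  simpa using (h.mono_left nhdsWithin_le_nhds).const_mul K

lemma tendsto_ofReal_const_mul_rpow (K : ℝ) {η : ℝ} (hη : 0 < η) :
    Tendsto (fun ε : ℝ => ENNReal.ofReal (K * ε ^ η)) (𝓝[>] 0) (𝓝 0) := by
  simpa using ENNReal.tendsto_ofReal (tendsto_const_mul_rpow K hη)

section Events

variable {Ω : Type*} [MeasurableSpace Ω] {P : Measure Ω} {h : Measure ℂ → Ω → ℝ}

/-- First moment bound: with high probability `∑_z exp (-b h_ε(z)) ≤ ε^{-(2 + b²/2) - η}`. -/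
lemma IsWholePlaneGFF.tendsto_sum_exp (hGFF : IsWholePlaneGFF h P) (b : ℝ) {η : ℝ} (hη : 0 < η) :
    Tendsto (fun ε : ℝ => P {ω | ε ^ (-(2 + b ^ 2 / 2) - η)
      < ∑ x : Grid ε, Real.exp (-b * circleAvg h ε (gridPoint ε x) ω)}) (𝓝[>] 0) (𝓝 0) := by
  refine tendsto_of_tendsto_of_tendsto_of_le_of_le' tendsto_const_nhds
    (tendsto_ofReal_const_mul_rpow (4 * Real.exp (2 * b ^ 2)) hη)
    (Eventually.of_forall fun _ => zero_le) ?_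
  filter_upwards [eventually_small one_pos] with ε ⟨hε, hε1⟩
  set θ : ℝ := ε ^ (-(2 + b ^ 2 / 2) - η) with hθ
  have hθ0 : 0 < θ := Real.rpow_pos_of_pos hε _
  have hX := fun x : Grid ε => hGFF.hasGaussianLaw_circleAvg_single hε (gridPoint ε x)
  have hint : ∫⁻ ω, ENNReal.ofReal
      (∑ x : Grid ε, Real.exp (-b * circleAvg h ε (gridPoint ε x) ω)) ∂P
      ≤ ENNReal.ofReal (4 * Real.exp (2 * b ^ 2) * ε ^ η * θ) := by
    calc ∫⁻ ω, ENNReal.ofReal (∑ x : Grid ε, Real.exp (-b * circleAvg h ε (gridPoint ε x) ω)) ∂P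
        = ∑ x : Grid ε, ∫⁻ ω, ENNReal.ofReal
            (Real.exp (-b * circleAvg h ε (gridPoint ε x) ω)) ∂P := by
          rw [← lintegral_finsetSum' _ fun x _ =>
            (integrable_exp_mul_of_hasGaussianLaw (hX x) (-b)).1.aemeasurable.ennreal_ofReal]
          exact lintegral_congr fun ω => ENNReal.ofReal_sum_of_nonneg fun x _ => (Real.exp_pos _).le
      _ ≤ ∑ _x : Grid ε, ENNReal.ofReal (Real.exp ((-Real.log ε + 4) * (-b) ^ 2 / 2)) :=
          Finset.sum_le_sum fun x _ => lintegral_exp_mul_le (hX x) (hGFF.integral_circleAvg hε _)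
            (hGFF.variance_circleAvg_le hε (norm_gridPoint_le hε hε1.le x)) (-b)
      _ = ENNReal.ofReal ((meshSize ε + 1 : ℝ) ^ 2
            * Real.exp ((-Real.log ε + 4) * (-b) ^ 2 / 2)) := by
          rw [Finset.sum_const, Finset.card_univ, ENNReal.ofReal_mul (by positivity), nsmul_eq_mul]
          congr 1
          rw [show (meshSize ε + 1 : ℝ) ^ 2 = ((Fintype.card (Grid ε) : ℕ) : ℝ) by
            simp [Fintype.card_prod, sq], ENNReal.ofReal_natCast]
      _ ≤ ENNReal.ofReal (4 * Real.exp (2 * b ^ 2) * ε ^ η * θ) := by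
          refine ENNReal.ofReal_le_ofReal ?_
          calc (meshSize ε + 1 : ℝ) ^ 2 * Real.exp ((-Real.log ε + 4) * (-b) ^ 2 / 2)
              ≤ 4 * ε ^ (-2 : ℝ) * Real.exp ((-Real.log ε + 4) * (-b) ^ 2 / 2) := by
                gcongr
                exact card_grid_le hε hε1.le
            _ = 4 * Real.exp (2 * b ^ 2) * ε ^ η * θ := by
                rw [hθ, Real.rpow_def_of_pos hε, Real.rpow_def_of_pos hε, Real.rpow_def_of_pos hε,
                  mul_assoc, mul_assoc, mul_assoc, ← Real.exp_add, ← Real.exp_add, ← Real.exp_add]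
                congr 2
                ring
  have hmeas : AEMeasurable (fun ω => ENNReal.ofReal
      (∑ x : Grid ε, Real.exp (-b * circleAvg h ε (gridPoint ε x) ω))) P :=
    (Finset.aemeasurable_fun_sum _ fun x _ =>
      (integrable_exp_mul_of_hasGaussianLaw (hX x) (-b)).1.aemeasurable).ennreal_ofReal
  have hmarkov := (mul_meas_ge_le_lintegral₀ hmeas (ENNReal.ofReal θ)).trans hint
  rw [ENNReal.ofReal_mul (by positivity), mul_comm] at hmarkov
  refine le_trans (measure_mono fun ω hω => ?_) ((ENNReal.mul_le_mul_iff_left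
    (by simpa using hθ0) ENNReal.ofReal_ne_top).1 hmarkov)
  exact ENNReal.ofReal_le_ofReal (le_of_lt hω)

/-- With high probability neighboring circle averages differ by at most `δ log (1/ε)`. -/
lemma IsWholePlaneGFF.tendsto_increment (hGFF : IsWholePlaneGFF h P) {δ : ℝ} (hδ : 0 < δ) :
    Tendsto (fun ε : ℝ => P {ω | ∃ x y : Grid ε, KingAdj x y ∧ δ * (-Real.log ε)
      < circleAvg h ε (gridPoint ε y) ω - circleAvg h ε (gridPoint ε x) ω}) (𝓝[>] 0) (𝓝 0) := by
  refine tendsto_of_tendsto_of_tendsto_of_le_of_le' tendsto_const_nhds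
    (tendsto_ofReal_const_mul_rpow (16 * Real.exp (50 / δ ^ 2)) one_pos)
    (Eventually.of_forall fun _ => zero_le) ?_
  filter_upwards [eventually_small one_pos] with ε ⟨hε, hε1⟩
  have hpair : ∀ q : Grid ε × Grid ε, P {ω | KingAdj q.1 q.2 ∧ δ * (-Real.log ε)
      < circleAvg h ε (gridPoint ε q.2) ω - circleAvg h ε (gridPoint ε q.1) ω}
      ≤ ENNReal.ofReal (Real.exp (50 / δ ^ 2) * ε ^ (5 : ℝ)) := by
    rintro ⟨x, y⟩
    by_cases hxy : KingAdj x y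
    · have hG : HasGaussianLaw (fun ω => circleAvg h ε (gridPoint ε y) ω
          - circleAvg h ε (gridPoint ε x) ω) P :=
        (hGFF.hasGaussianLaw_circleAvg hε (ι := Bool) fun i =>
          if i then gridPoint ε y else gridPoint ε x).prodMk true false |>.fun_sub
      have h0 : ∫ ω, (circleAvg h ε (gridPoint ε y) ω - circleAvg h ε (gridPoint ε x) ω) ∂P = 0 := by
        rw [integral_sub (hGFF.hasGaussianLaw_circleAvg_single hε _).integrable
          (hGFF.hasGaussianLaw_circleAvg_single hε _).integrable, hGFF.integral_circleAvg hε,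
          hGFF.integral_circleAvg hε, sub_zero]
      have hv := hGFF.variance_circleAvg_sub_le hε (norm_gridPoint_sub_le hε hxy.symm)
      -- The choice `t = 5 / δ` gives a tail of order `ε^5`, which beats the `O(ε^{-4})` pairs of
      -- vertices.
      refine (measure_mono fun ω hω => hω.2).trans
        ((measure_lt_le_exp hG h0 hv (t := 5 / δ) (by positivity) (δ * (-Real.log ε))).trans ?_)
      refine ENNReal.ofReal_le_ofReal (le_of_eq ?_)
      rw [Real.rpow_def_of_pos hε, ← Real.exp_add]
      congr 1
      field_simp
      ring
    · have : {ω | KingAdj x y ∧ δ * (-Real.log ε)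
          < circleAvg h ε (gridPoint ε y) ω - circleAvg h ε (gridPoint ε x) ω} = ∅ :=
        Set.eq_empty_of_forall_notMem fun ω hω => hxy hω.1
      simp only [this, measure_empty]
      exact zero_le
  calc P {ω | ∃ x y : Grid ε, KingAdj x y ∧ δ * (-Real.log ε)
        < circleAvg h ε (gridPoint ε y) ω - circleAvg h ε (gridPoint ε x) ω}
      ≤ P (⋃ q : Grid ε × Grid ε, {ω | KingAdj q.1 q.2 ∧ δ * (-Real.log ε)
        < circleAvg h ε (gridPoint ε q.2) ω - circleAvg h ε (gridPoint ε q.1) ω}) := by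
        refine measure_mono fun ω hω => ?_
        obtain ⟨x, y, hxy⟩ := hω
        exact Set.mem_iUnion.2 ⟨(x, y), hxy⟩
    _ ≤ ∑ q : Grid ε × Grid ε, P {ω | KingAdj q.1 q.2 ∧ δ * (-Real.log ε)
        < circleAvg h ε (gridPoint ε q.2) ω - circleAvg h ε (gridPoint ε q.1) ω} :=
        measure_iUnion_fintype_le _ _
    _ ≤ ∑ _q : Grid ε × Grid ε, ENNReal.ofReal (Real.exp (50 / δ ^ 2) * ε ^ (5 : ℝ)) :=
        Finset.sum_le_sum fun q _ => hpair q
    _ = ENNReal.ofReal (((meshSize ε + 1 : ℝ) ^ 2) ^ 2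
          * (Real.exp (50 / δ ^ 2) * ε ^ (5 : ℝ))) := by
        rw [Finset.sum_const, Finset.card_univ, nsmul_eq_mul,
          ENNReal.ofReal_mul (p := ((meshSize ε + 1 : ℝ) ^ 2) ^ 2) (by positivity)]
        congr 1
        rw [show ((meshSize ε + 1 : ℝ) ^ 2) ^ 2 = ((Fintype.card (Grid ε × Grid ε) : ℕ) : ℝ) by
          simp [Fintype.card_prod, sq], ENNReal.ofReal_natCast]
    _ ≤ ENNReal.ofReal (16 * Real.exp (50 / δ ^ 2) * ε ^ (1 : ℝ)) := by
        refine ENNReal.ofReal_le_ofReal ?_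
        calc ((meshSize ε + 1 : ℝ) ^ 2) ^ 2 * (Real.exp (50 / δ ^ 2) * ε ^ (5 : ℝ))
            ≤ (4 * ε ^ (-2 : ℝ)) ^ 2 * (Real.exp (50 / δ ^ 2) * ε ^ (5 : ℝ)) := by
              gcongr
              exact card_grid_le hε hε1.le
          _ = 16 * Real.exp (50 / δ ^ 2) * (ε ^ (-2 : ℝ) * ε ^ (-2 : ℝ) * ε ^ (5 : ℝ)) := by ring
          _ = 16 * Real.exp (50 / δ ^ 2) * ε ^ (1 : ℝ) := by
              rw [← Real.rpow_add hε, ← Real.rpow_add hε]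
              norm_num

/-! ### Crossings at level zero and concentration -/

/-- Puts the crossing event in the min-max form over a finite family required by
`gaussian_minMax_concentration`. -/
lemma setOf_hasCrossing {n : ℕ} [DecidablePred fun γ : Finset (Fin (n + 1) × Fin (n + 1)) =>
      HasCrossing (γ : Set (Fin (n + 1) × Fin (n + 1)))] (a : ℝ) :
    {u : Fin (n + 1) × Fin (n + 1) → ℝ | HasCrossing {x | u x ≤ a}}
      = {u | ∃ γ ∈ Finset.univ.filter fun γ : Finset (Fin (n + 1) × Fin (n + 1)) =>
          HasCrossing (γ : Set (Fin (n + 1) × Fin (n + 1))), ∀ z ∈ γ, u z ≤ a} := by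
  classical
  ext u
  simp only [Set.mem_ofPred_eq, Finset.mem_filter, Finset.mem_univ, true_and]
  constructor
  · intro hu
    exact ⟨Finset.univ.filter fun x => u x ≤ a, by simpa using hu, by simp⟩
  · rintro ⟨γ, hγ, hu⟩
    exact hγ.mono fun z hz => hu z hz

lemma measurableSet_hasCrossing {n : ℕ} (a : ℝ) :
    MeasurableSet {u : Fin (n + 1) × Fin (n + 1) → ℝ | HasCrossing {x | u x ≤ a}} := by
  classical
  rw [setOf_hasCrossing]
  have : {u : Fin (n + 1) × Fin (n + 1) → ℝ |
      ∃ γ ∈ Finset.univ.filter fun γ : Finset (Fin (n + 1) × Fin (n + 1)) =>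
        HasCrossing (γ : Set (Fin (n + 1) × Fin (n + 1))), ∀ z ∈ γ, u z ≤ a}
      = ⋃ γ ∈ Finset.univ.filter fun γ : Finset (Fin (n + 1) × Fin (n + 1)) =>
        HasCrossing (γ : Set (Fin (n + 1) × Fin (n + 1))), ⋂ z ∈ γ, {u | u z ≤ a} := by
    ext u; simp
  rw [this]
  exact Finset.measurableSet_biUnion _ fun γ _ => Finset.measurableSet_biInter _ fun z _ =>
    measurableSet_le (measurable_pi_apply z) measurable_const

/-- The circle averages at the vertices of `𝕊^ε`, as a random vector. -/
def gridField (h : Measure ℂ → Ω → ℝ) (ε : ℝ) (ω : Ω) (x : Grid ε) : ℝ :=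
  circleAvg h ε (gridPoint ε x) ω

lemma IsWholePlaneGFF.hasGaussianLaw_gridField (hGFF : IsWholePlaneGFF h P) {ε : ℝ} (hε : 0 < ε) :
    HasGaussianLaw (gridField h ε) P := hGFF.hasGaussianLaw_circleAvg hε (gridPoint ε)

/-- The law of the field is invariant under reflection across the diagonal and change of sign. -/
lemma IsWholePlaneGFF.map_neg_swap_gridField (hGFF : IsWholePlaneGFF h P) {ε : ℝ} (hε : 0 < ε) :
    P.map (fun ω (x : Grid ε) => -gridField h ε ω x.swap) = P.map (gridField h ε) := by
  have h1 : HasGaussianLaw (fun ω (x : Grid ε) => gridField h ε ω x.swap) P :=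
    hGFF.hasGaussianLaw_circleAvg hε fun x : Grid ε => gridPoint ε x.swap
  refine map_eq_map_of_covariance_eq (X := fun x ω => -gridField h ε ω x.swap)
    (Y := fun x ω => gridField h ε ω x) h1.neg (hGFF.hasGaussianLaw_gridField hε) ?_ ?_ ?_
  · intro x
    rw [integral_neg, neg_eq_zero]
    exact hGFF.integral_circleAvg hε _
  · intro x
    exact hGFF.integral_circleAvg hε _
  · intro x y
    rw [covariance_fun_neg_left, covariance_fun_neg_right, neg_neg]
    change covariance (circleAvg h ε (gridPoint ε x.swap)) (circleAvg h ε (gridPoint ε y.swap)) P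
      = covariance (circleAvg h ε (gridPoint ε x)) (circleAvg h ε (gridPoint ε y)) P
    rw [hGFF.covariance_circleAvg hε, hGFF.covariance_circleAvg hε, ← reflect_gridPoint,
      ← reflect_gridPoint, circleCov_reflect]

/-- By duality every configuration lies in the event or in its preimage under `u ↦ -u ∘ swap`, which
preserves the law. -/
lemma IsWholePlaneGFF.half_le_hasCrossing (hGFF : IsWholePlaneGFF h P) {ε : ℝ} (hε : 0 < ε) :
    2⁻¹ ≤ P.map (gridField h ε) {u : Grid ε → ℝ | HasCrossing {x | u x ≤ 0}} := by
  have hG := hGFF.hasGaussianLaw_gridField hε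
  have := hG.isGaussian_map
  have hprob := hG.isProbabilityMeasure
  set μ := P.map (gridField h ε) with hμ
  set A := {u : Grid ε → ℝ | HasCrossing {x | u x ≤ 0}} with hA
  have hR : Measurable fun (u : Grid ε → ℝ) (x : Grid ε) => -u x.swap := by fun_prop
  have hinv : μ.map (fun (u : Grid ε → ℝ) (x : Grid ε) => -u x.swap) = μ := by
    rw [hμ, AEMeasurable.map_map_of_aemeasurable hR.aemeasurable hG.aemeasurable]
    exact hGFF.map_neg_swap_gridField hε
  have hcover : (Set.univ : Set (Grid ε → ℝ))
      ⊆ A ∪ (fun (u : Grid ε → ℝ) (x : Grid ε) => -u x.swap) ⁻¹' A := by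
    intro u _
    rcases hasCrossing_or {x : Grid ε | u x ≤ 0} with h1 | h1
    · exact Or.inl h1
    · refine Or.inr (h1.mono fun x hx => ?_)
      simp only [Set.mem_ofPred_eq, not_le] at hx ⊢
      linarith
  have h1 : 1 ≤ μ A + μ A := by
    calc 1 = μ Set.univ := (measure_univ (μ := μ)).symm
      _ ≤ μ A + μ ((fun (u : Grid ε → ℝ) (x : Grid ε) => -u x.swap) ⁻¹' A) :=
          (measure_mono hcover).trans (measure_union_le _ _)
      _ = μ A + μ A := by
          rw [← Measure.map_apply hR (measurableSet_hasCrossing 0), hinv]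
  rw [← two_mul] at h1
  exact (ENNReal.inv_le_iff_le_mul (by simp) (by simp)).2 h1

/-- Concentration between the levels `0` and `b`, where the event at level `0` has probability at
least `1/2`. -/
lemma IsWholePlaneGFF.measure_not_hasCrossing_le (hGFF : IsWholePlaneGFF h P) {ε : ℝ} (hε : 0 < ε)
    (hε1 : ε ≤ 1) {b : ℝ} (hb : 2 < b) :
    P {ω | ¬HasCrossing {x : Grid ε | gridField h ε ω x ≤ b}}
      ≤ ENNReal.ofReal (Real.pi * Real.sqrt (-Real.log ε + 4) / (b - 2)) := by
  classical
  have hG := hGFF.hasGaussianLaw_gridField hε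
  have := hG.isGaussian_map
  have hprob := hG.isProbabilityMeasure
  set μ := P.map (gridField h ε) with hμ
  have hμ0 : μ[id] = 0 := by
    rw [hμ, integral_map hG.aemeasurable (by fun_prop)]
    funext x
    simp only [id_eq]
    rw [eval_integral fun x => (hG.eval x).integrable]
    exact hGFF.integral_circleAvg hε _
  have hlog : 0 ≤ -Real.log ε := neg_nonneg.2 (Real.log_nonpos hε.le hε1)
  have hσ : ∀ z : Grid ε, ∫ u, |u z| ∂μ ≤ Real.sqrt (-Real.log ε + 4) := by
    intro z
    rw [hμ, integral_map hG.aemeasurable (measurable_pi_apply z).abs.aestronglyMeasurable]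
    exact integral_abs_le_sqrt (hGFF.hasGaussianLaw_circleAvg_single hε _)
      (hGFF.integral_circleAvg hε _) (by linarith)
      (hGFF.variance_circleAvg_le hε (norm_gridPoint_le hε hε1 z))
  have hconc := gaussian_minMax_concentration (μ := μ) hμ0
    (Γ := Finset.univ.filter fun γ : Finset (Grid ε) => HasCrossing (γ : Set (Grid ε)))
    ⟨Finset.univ, by simpa using hasCrossing_univ⟩
    (fun γ hγ => by
      obtain ⟨b, -, hb⟩ := (Finset.mem_filter.1 hγ).2
      exact ⟨b, hb.mem⟩) hσ 0 b
  have hcompl : {u : Grid ε → ℝ | ¬∃ γ ∈ Finset.univ.filter fun γ : Finset (Grid ε) =>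
      HasCrossing (γ : Set (Grid ε)), ∀ z ∈ γ, u z ≤ b}
      = {u : Grid ε → ℝ | HasCrossing {x | u x ≤ b}}ᶜ := by
    rw [setOf_hasCrossing]; rfl
  rw [hcompl, ← setOf_hasCrossing, sub_zero] at hconc
  have hP : P {ω | ¬HasCrossing {x : Grid ε | gridField h ε ω x ≤ b}}
      = μ {u : Grid ε → ℝ | HasCrossing {x | u x ≤ b}}ᶜ := by
    rw [hμ, Measure.map_apply_of_aemeasurable hG.aemeasurable (measurableSet_hasCrossing b).compl]
    rfl
  rw [hP]
  have hhalf := hGFF.half_le_hasCrossing hε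
  set q := μ {u : Grid ε → ℝ | HasCrossing {x | u x ≤ b}}ᶜ with hq
  have h2 : ENNReal.ofReal (b - 2) * (2⁻¹ * q)
      ≤ ENNReal.ofReal (Real.pi / 2) * ENNReal.ofReal (Real.sqrt (-Real.log ε + 4)) :=
    le_trans (by gcongr) hconc
  have hb' : 0 < b - 2 := by linarith
  have h2' : ENNReal.ofReal 2⁻¹ = 2⁻¹ := by
    rw [ENNReal.ofReal_inv_of_pos two_pos]; norm_num
  rw [← h2', ← mul_assoc, ← ENNReal.ofReal_mul hb'.le, ← ENNReal.ofReal_mul (by positivity),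
    mul_comm] at h2
  rw [← ENNReal.le_div_iff_mul_le (Or.inl (by simpa using hb)) (Or.inl ENNReal.ofReal_ne_top),
    ← ENNReal.ofReal_div_of_pos (by positivity)] at h2
  refine h2.trans (le_of_eq ?_)
  congr 1
  field_simp

/-- With high probability there is a crossing along which the field is at most `δ log (1/ε)`. -/
lemma IsWholePlaneGFF.tendsto_not_hasCrossing (hGFF : IsWholePlaneGFF h P) {δ : ℝ} (hδ : 0 < δ) :
    Tendsto (fun ε : ℝ => P {ω | ¬HasCrossing {x : Grid ε | gridField h ε ω x
      ≤ δ * (-Real.log ε)}}) (𝓝[>] 0) (𝓝 0) := by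
  have hlog : Tendsto (fun ε : ℝ => -Real.log ε) (𝓝[>] 0) atTop :=
    tendsto_neg_atBot_atTop.comp Real.tendsto_log_nhdsGT_zero
  have hlim : Tendsto (fun T : ℝ => Real.pi * (2 * Real.sqrt T) / (δ / 2 * T)) atTop (𝓝 0) := by
    have h1 : Tendsto (fun T : ℝ => Real.pi * 2 / (δ / 2) * (Real.sqrt T)⁻¹) atTop (𝓝 0) := by
      simpa using (tendsto_inv_atTop_zero.comp Real.tendsto_sqrt_atTop).const_mul
        (Real.pi * 2 / (δ / 2))
    refine h1.congr' ?_
    filter_upwards [eventually_gt_atTop 0] with T hT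
    have hs := Real.sqrt_pos.2 hT
    have : T = Real.sqrt T * Real.sqrt T := (Real.mul_self_sqrt hT.le).symm
    nth_rewrite 3 [this]
    field_simp
  have hlim' := ENNReal.tendsto_ofReal (hlim.comp hlog)
  rw [ENNReal.ofReal_zero] at hlim'
  refine tendsto_of_tendsto_of_tendsto_of_le_of_le' tendsto_const_nhds hlim'
    (Eventually.of_forall fun _ => zero_le) ?_
  -- The threshold gives `δT > 4` and `T > 4`, hence `δT - 2 ≥ δT/2` and `T + 4 ≤ 4T`.
  filter_upwards [eventually_small one_pos, hlog.eventually_ge_atTop (4 / δ + 4)]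
    with ε ⟨hε, hε1⟩ hT
  set T := -Real.log ε with hTdef
  have h4 : 0 < 4 / δ := by positivity
  have hδT : 4 < δ * T := by
    have : δ * (4 / δ) = 4 := by field_simp
    nlinarith
  refine (hGFF.measure_not_hasCrossing_le hε hε1.le (b := δ * T) (by linarith)).trans
    (ENNReal.ofReal_le_ofReal ?_)
  simp only [Function.comp_apply, ← hTdef]
  have hsqrt : Real.sqrt (T + 4) ≤ 2 * Real.sqrt T := by
    rw [Real.sqrt_le_left (by positivity), mul_pow, Real.sq_sqrt (by linarith)]
    linarith
  have hT0 : 0 < T := by linarith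
  gcongr
  linarith

end Events

/-- Subadditivity alone is used, so the event `A ε`, a condition on all paths in the applications,
need not be shown measurable. -/
lemma tendsto_measure_one {Ω : Type*} [MeasurableSpace Ω] {P : Measure Ω} [IsProbabilityMeasure P]
    {l : Filter ℝ} {A B : ℝ → Set Ω} (hAB : ∀ᶠ ε in l, (A ε)ᶜ ⊆ B ε)
    (hB : Tendsto (fun ε => P (B ε)) l (𝓝 0)) : Tendsto (fun ε => P (A ε)) l (𝓝 1) := by
  have hlim : Tendsto (fun ε => 1 - P (B ε)) l (𝓝 1) := by
    simpa using ENNReal.Tendsto.sub tendsto_const_nhds hB (Or.inl ENNReal.one_ne_top)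
  refine tendsto_of_tendsto_of_tendsto_of_le_of_le' hlim tendsto_const_nhds ?_
    (Eventually.of_forall fun ε => prob_le_one)
  filter_upwards [hAB] with ε hε
  rw [tsub_le_iff_right]
  calc 1 = P Set.univ := measure_univ.symm
    _ ≤ P (A ε ∪ B ε) := measure_mono fun ω _ => by
        by_cases hω : ω ∈ A ε
        · exact Or.inl hω
        · exact Or.inr (hε hω)
    _ ≤ P (A ε) + P (B ε) := measure_union_le _ _

/-! ### Elementary bounds for the distances -/

section Deterministic

variable {f : ℂ → ℝ} {ε ξ : ℝ}

lemma pathLength_nonneg (hε : 0 < ε) {N : ℕ} (p : Fin (N + 1) → ℂ) : 0 ≤ pathLength f ε ξ p :=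
  Finset.sum_nonneg fun _ _ => mul_nonneg hε.le (Real.exp_pos _).le

lemma vertexDist_le (hε : 0 < ε) {N : ℕ} {p : Fin (N + 1) → ℂ} (hp : IsLatticePath ε p) :
    vertexDist f ε ξ (p 0) (p (Fin.last N)) ≤ pathLength f ε ξ p := by
  refine csInf_le ⟨0, ?_⟩ ⟨N, p, hp, rfl, rfl, rfl⟩
  rintro _ ⟨N, p, -, -, -, rfl⟩
  exact pathLength_nonneg hε p

lemma vertexDist_nonneg (hε : 0 < ε) (z w : ℂ) : 0 ≤ vertexDist f ε ξ z w := by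
  refine Real.sInf_nonneg ?_
  rintro _ ⟨N, p, -, -, -, rfl⟩
  exact pathLength_nonneg hε p

lemma crossingDist_le (hε : 0 < ε) {z w : ℂ} (hz : z ∈ leftBoundary ε) (hw : w ∈ rightBoundary ε) :
    crossingDist f ε ξ ≤ vertexDist f ε ξ z w := by
  refine csInf_le ⟨0, ?_⟩ ⟨z, hz, w, hw, rfl⟩
  rintro _ ⟨z, -, w, -, rfl⟩
  exact vertexDist_nonneg hε z w

lemma le_pathLength (hε : 0 < ε) (hξ : 0 ≤ ξ) {a : ℝ} (ha : ∀ x : Grid ε, a ≤ f (gridPoint ε x))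
    {N : ℕ} {p : Fin (N + 1) → ℂ} (hp : IsLatticePath ε p) :
    ε * Real.exp (ξ * a) ≤ pathLength f ε ξ p := by
  obtain ⟨x, hx⟩ := exists_gridPoint_eq hε (hp.1 0)
  calc ε * Real.exp (ξ * a) ≤ ε * Real.exp (ξ * f (p 0)) := by
        rw [← hx]; gcongr; exact ha x
    _ ≤ pathLength f ε ξ p := Finset.single_le_sum (f := fun j => ε * Real.exp (ξ * f (p j)))
        (fun _ _ => mul_nonneg hε.le (Real.exp_pos _).le) (Finset.mem_univ _)

lemma le_vertexDist (hε : 0 < ε) (hξ : 0 ≤ ξ) {a : ℝ} (ha : ∀ x : Grid ε, a ≤ f (gridPoint ε x))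
    {z w : ℂ} (hz : z ∈ lattice ε) (hw : w ∈ lattice ε) :
    ε * Real.exp (ξ * a) ≤ vertexDist f ε ξ z w := by
  obtain ⟨x, rfl⟩ := exists_gridPoint_eq hε hz
  obtain ⟨y, rfl⟩ := exists_gridPoint_eq hε hw
  obtain ⟨N, p, -, hp0, hpN, -, hp⟩ := exists_path_of_reachable (Set.mem_univ x) (reachable_univ x y)
  refine le_csInf ⟨_, N, _, isLatticePath_of_nnGraph hε hp, by rw [hp0], by rw [hpN], rfl⟩ ?_
  rintro _ ⟨N, p, hp, -, -, rfl⟩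
  exact le_pathLength hε hξ ha hp

lemma le_crossingDist (hε : 0 < ε) (hξ : 0 ≤ ξ) {a : ℝ} (ha : ∀ x : Grid ε, a ≤ f (gridPoint ε x)) :
    ε * Real.exp (ξ * a) ≤ crossingDist f ε ξ := by
  refine le_csInf ⟨_, _, gridPoint_mem_leftBoundary hε (x := (0, 0)) rfl, _,
    gridPoint_mem_rightBoundary hε (x := (Fin.last _, 0)) rfl, rfl⟩ ?_
  rintro _ ⟨z, hz, w, hw, rfl⟩
  exact le_vertexDist hε hξ ha hz.1 hw.1

/-- The extra `b` pays for passing from king moves to nearest-neighbor moves. The crossing then has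
at most `4 ε^{-2}` vertices, each of cost at most `ε exp (ξ (a + b))`. -/
lemma crossingDist_le_of_hasCrossing (hε : 0 < ε) (hε1 : ε ≤ 1) (hξ : 0 ≤ ξ) {a b : ℝ}
    (hcross : HasCrossing {x : Grid ε | f (gridPoint ε x) ≤ a})
    (hinc : ∀ x y : Grid ε, KingAdj x y → f (gridPoint ε y) - f (gridPoint ε x) ≤ b) :
    crossingDist f ε ξ ≤ 4 * ε ^ (-1 : ℝ) * Real.exp (ξ * (a + b)) := by
  obtain ⟨x, y, hx, hx0, hy0, hxy⟩ := hcross.exists_reachable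
    (S' := {x : Grid ε | f (gridPoint ε x) ≤ a + b})
    fun x hx y hxy => by
      have h1 := hinc x y hxy
      have h2 : f (gridPoint ε x) ≤ a := hx
      change f (gridPoint ε y) ≤ a + b
      linarith
  obtain ⟨N, p, hN, hp0, hpN, hpS, hp⟩ := exists_path_of_reachable hx hxy
  have hpath := isLatticePath_of_nnGraph hε hp
  have hN' : (N + 1 : ℝ) ≤ (meshSize ε + 1 : ℝ) ^ 2 := by exact_mod_cast hN
  calc crossingDist f ε ξ
      ≤ vertexDist f ε ξ (gridPoint ε (p 0)) (gridPoint ε (p (Fin.last N))) :=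
        crossingDist_le hε (gridPoint_mem_leftBoundary hε (by rw [hp0, hx0]))
          (gridPoint_mem_rightBoundary hε (by rw [hpN, hy0]))
    _ ≤ pathLength f ε ξ fun j => gridPoint ε (p j) := vertexDist_le hε hpath
    _ ≤ ∑ _j : Fin (N + 1), ε * Real.exp (ξ * (a + b)) := by
        refine Finset.sum_le_sum fun j _ => ?_
        have := hpS j
        gcongr
        exact this
    _ = (N + 1 : ℝ) * (ε * Real.exp (ξ * (a + b))) := by simp
    _ ≤ 4 * ε ^ (-2 : ℝ) * (ε * Real.exp (ξ * (a + b))) := by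
        gcongr
        exact hN'.trans (card_grid_le hε hε1)
    _ = 4 * (ε ^ (-2 : ℝ) * ε ^ (1 : ℝ)) * Real.exp (ξ * (a + b)) := by rw [Real.rpow_one]; ring
    _ = 4 * ε ^ (-1 : ℝ) * Real.exp (ξ * (a + b)) := by
        rw [← Real.rpow_add hε]; norm_num

/-- Comparison of the lengths of an injective path for two parameters: the vertices at which
`f ≥ -c` are controlled by the length of the path, the others by an exponential sum over all
vertices. -/
lemma pathLength_le_of_injective (hε : 0 < ε) {ξ' b c : ℝ} (hξ : ξ' ≤ ξ) (hb : 0 ≤ ξ' + b)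
    {N : ℕ} {p : Fin (N + 1) → ℂ} (hp : IsLatticePath ε p) (hinj : Function.Injective p) :
    pathLength f ε ξ' p ≤ Real.exp ((ξ - ξ') * c) * pathLength f ε ξ p
      + ε * Real.exp (-(ξ' + b) * c) * ∑ x : Grid ε, Real.exp (-b * f (gridPoint ε x)) := by
  choose x hx using fun j => exists_gridPoint_eq hε (hp.1 j)
  have hxinj : Function.Injective x := fun i j hij => hinj (by rw [← hx i, ← hx j, hij])
  have hpt : ∀ j, ε * Real.exp (ξ' * f (p j))
      ≤ Real.exp ((ξ - ξ') * c) * (ε * Real.exp (ξ * f (p j)))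
        + ε * Real.exp (-(ξ' + b) * c) * Real.exp (-b * f (p j)) := by
    intro j
    rcases le_total (-c) (f (p j)) with h | h
    · refine le_add_of_le_of_nonneg ?_ (by positivity)
      calc ε * Real.exp (ξ' * f (p j))
          ≤ ε * Real.exp ((ξ - ξ') * c + ξ * f (p j)) := by
            gcongr
            nlinarith
        _ = _ := by rw [Real.exp_add]; ring
    · refine le_add_of_nonneg_of_le (by positivity) ?_
      rw [mul_assoc, ← Real.exp_add]
      gcongr
      nlinarith
  calc pathLength f ε ξ' p
      ≤ ∑ j, (Real.exp ((ξ - ξ') * c) * (ε * Real.exp (ξ * f (p j)))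
        + ε * Real.exp (-(ξ' + b) * c) * Real.exp (-b * f (p j))) :=
        Finset.sum_le_sum fun j _ => hpt j
    _ = Real.exp ((ξ - ξ') * c) * pathLength f ε ξ p
        + ε * Real.exp (-(ξ' + b) * c) * ∑ j, Real.exp (-b * f (gridPoint ε (x j))) := by
        simp only [hx, pathLength, Finset.mul_sum, Finset.sum_add_distrib]
    _ ≤ _ := by
        gcongr
        -- Injectivity makes each vertex count once, so the sum along the path is at most the sum
        -- over the lattice.
        rw [← Finset.sum_image (f := fun x => Real.exp (-b * f (gridPoint ε x)))
          (s := Finset.univ) (g := x) fun i _ j _ hij => hxinj hij]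
        exact Finset.sum_le_sum_of_subset_of_nonneg (Finset.subset_univ _)
          fun _ _ _ => (Real.exp_pos _).le

end Deterministic

/-! ### The distance exponent -/

section Exponent

variable {Ω : Type*} [MeasurableSpace Ω] {P : Measure Ω} {h : Measure ℂ → Ω → ℝ}

lemma IsWholePlaneGFF.tendsto_crossingDist_le [IsProbabilityMeasure P] (hGFF : IsWholePlaneGFF h P)
    {ξ : ℝ} (hξ : 0 ≤ ξ) {α : ℝ} (hα : α < -1) :
    Tendsto (fun ε : ℝ => P {ω | crossingDist (fun z => circleAvg h ε z ω) ε ξ ≤ ε ^ α})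
      (𝓝[>] 0) (𝓝 1) := by
  set η : ℝ := (-1 - α) / 2 with hη
  have hη0 : 0 < η := by rw [hη]; linarith
  set δ : ℝ := η / (2 * (ξ + 1)) with hδ
  have hδ0 : 0 < δ := by positivity
  have hξδ : 2 * ξ * δ ≤ η := by
    rw [hδ, mul_div_assoc', div_le_iff₀ (by positivity)]
    nlinarith
  have hbad := (hGFF.tendsto_not_hasCrossing hδ0).add (hGFF.tendsto_increment hδ0)
  rw [add_zero] at hbad
  refine tendsto_measure_one (B := fun ε =>
    {ω | ¬HasCrossing {x : Grid ε | gridField h ε ω x ≤ δ * (-Real.log ε)}} ∪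
    {ω | ∃ x y : Grid ε, KingAdj x y ∧ δ * (-Real.log ε)
      < circleAvg h ε (gridPoint ε y) ω - circleAvg h ε (gridPoint ε x) ω}) ?_
    (tendsto_of_tendsto_of_tendsto_of_le_of_le tendsto_const_nhds hbad (fun _ => zero_le)
      fun _ => measure_union_le _ _)
  filter_upwards [eventually_small one_pos,
    (tendsto_const_mul_rpow 4 hη0).eventually_le_const one_pos] with ε ⟨hε, hε1⟩ h4
  intro ω hω
  by_contra hcon
  simp only [Set.mem_union, Set.mem_ofPred_eq, not_or, not_not, not_exists, not_and, not_lt] at hcon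
  refine hω ?_
  calc crossingDist (fun z => circleAvg h ε z ω) ε ξ
      ≤ 4 * ε ^ (-1 : ℝ) * Real.exp (ξ * (δ * (-Real.log ε) + δ * (-Real.log ε))) :=
        crossingDist_le_of_hasCrossing hε hε1.le hξ hcon.1 hcon.2
    _ = 4 * ε ^ (-1 - 2 * ξ * δ) := by
        rw [Real.rpow_def_of_pos hε, Real.rpow_def_of_pos hε, mul_assoc, ← Real.exp_add]
        congr 2
        ring
    _ ≤ 4 * ε ^ (η + α) := by
        have : η + α ≤ -1 - 2 * ξ * δ := by rw [hη] at hξδ ⊢; linarith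
        have := Real.rpow_le_rpow_of_exponent_ge hε hε1.le this
        linarith
    _ = 4 * ε ^ η * ε ^ α := by rw [Real.rpow_add hε]; ring
    _ ≤ ε ^ α := mul_le_of_le_one_left (Real.rpow_pos_of_pos hε _).le h4

lemma IsWholePlaneGFF.tendsto_crossingDist_lt (hGFF : IsWholePlaneGFF h P) {ξ : ℝ} (hξ : 0 ≤ ξ)
    {α : ℝ} (hα : 1 + 3 * ξ < α) :
    Tendsto (fun ε : ℝ => P {ω | crossingDist (fun z => circleAvg h ε z ω) ε ξ ≤ ε ^ α})
      (𝓝[>] 0) (𝓝 0) := by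
  refine tendsto_of_tendsto_of_tendsto_of_le_of_le' tendsto_const_nhds
    -- With `b = η = 2` the sum is at most `ε^{-6}`, which forces `h_ε ≥ 3 log ε` at every vertex; a
    -- single vertex of the crossing then gives the bound.
    (hGFF.tendsto_sum_exp 2 two_pos) (Eventually.of_forall fun _ => zero_le) ?_
  filter_upwards [eventually_small one_pos] with ε ⟨hε, hε1⟩
  refine measure_mono fun ω hω => ?_
  by_contra hcon
  simp only [Set.mem_ofPred_eq, not_lt] at hcon
  have hlow : ∀ x : Grid ε, 3 * Real.log ε ≤ circleAvg h ε (gridPoint ε x) ω := by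
    intro x
    have h1 : Real.exp (-2 * circleAvg h ε (gridPoint ε x) ω)
        ≤ ε ^ (-(2 + (2 : ℝ) ^ 2 / 2) - 2) :=
      (Finset.single_le_sum (f := fun x : Grid ε =>
        Real.exp (-2 * circleAvg h ε (gridPoint ε x) ω)) (fun _ _ => (Real.exp_pos _).le)
        (Finset.mem_univ x)).trans hcon
    rw [Real.rpow_def_of_pos hε, Real.exp_le_exp] at h1
    linarith
  have h1 := le_crossingDist (f := fun z => circleAvg h ε z ω) hε hξ hlow
  have h2 : ε ^ α < ε ^ (1 + 3 * ξ) := Real.rpow_lt_rpow_of_exponent_gt hε hε1 hα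
  have h3 : ε ^ (1 + 3 * ξ) = ε * Real.exp (ξ * (3 * Real.log ε)) := by
    rw [Real.rpow_add hε, Real.rpow_one, Real.rpow_def_of_pos hε]
    congr 2
    ring
  have h4 : crossingDist (fun z => circleAvg h ε z ω) ε ξ ≤ ε ^ α := hω
  linarith

/-- The distance exponent is at least `-1`: by planar duality, symmetry and concentration there are
crossings along which the circle averages are at most of order `o (log (1/ε))`. -/
lemma IsWholePlaneGFF.neg_one_le_distExponent [IsProbabilityMeasure P] (hGFF : IsWholePlaneGFF h P)
    {ξ : ℝ} (hξ : 0 ≤ ξ) : -1 ≤ distExponent h P ξ := by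
  refine le_of_forall_lt fun α hα => ?_
  obtain ⟨β, hαβ, hβ⟩ := exists_between hα
  -- The upper bound `1 + 3ξ` is required for the real supremum to dominate its elements.
  refine hαβ.trans_le (le_csSup ⟨1 + 3 * ξ, ?_⟩ ?_)
  · intro γ hγ
    by_contra hlt
    have h0 := (hGFF.tendsto_crossingDist_lt hξ (not_le.1 hlt)).liminf_eq
    exact zero_ne_one (h0.symm.trans hγ)
  · exact (hGFF.tendsto_crossingDist_le hξ hβ).liminf_eq

end Exponent

end LFPP

end

/-! ### Comparison of the lengths for two parameters -/

theorem theorem2p1 {Ω : Type*} [MeasurableSpace Ω] (P : Measure Ω) [IsProbabilityMeasure P]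
    (h : Measure ℂ → Ω → ℝ) (hGFF : LFPP.IsWholePlaneGFF h P)
    (ξ' ξ ζ : ℝ) (hξ' : 0 ≤ ξ') (hξ : ξ' ≤ ξ) (hζ : 0 < ζ) :
    Tendsto (fun ε : ℝ => P {ω | ∀ (N : ℕ) (p : Fin (N + 1) → ℂ),
        LFPP.IsLatticePath ε p → Function.Injective p →
        LFPP.pathLength (fun z => LFPP.circleAvg h ε z ω) ε ξ p
          ≤ ε ^ (LFPP.distExponent h P ξ - ζ) →
        LFPP.pathLength (fun z => LFPP.circleAvg h ε z ω) ε ξ' p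
          ≤ ε ^ (LFPP.distExponent h P ξ
              - (ξ - ξ') * (Real.sqrt (2 + 2 * LFPP.distExponent h P ξ + ξ ^ 2) - ξ) - ζ)})
      (𝓝[>] (0 : ℝ)) (𝓝 1) := by
  rcases hξ.eq_or_lt with rfl | hlt
  -- The case `ξ' = ξ` is separate because the general one needs `ε^{(ξ - ξ') δ} → 0`.
  · refine LFPP.tendsto_measure_one (B := fun _ => ∅) (Eventually.of_forall fun ε ω hω => ?_)
      (by simp)
    exact hω fun N p _ _ hL => by simpa using hL
  have hξ0 : 0 ≤ ξ := hξ'.trans hξ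
  have hlam := hGFF.neg_one_le_distExponent hξ0
  set lam := LFPP.distExponent h P ξ with hlamdef
  set b : ℝ := Real.sqrt (2 + 2 * lam + ξ ^ 2) - ξ with hb
  have hsq : (b + ξ) ^ 2 = 2 + 2 * lam + ξ ^ 2 := by
    rw [hb, sub_add_cancel, Real.sq_sqrt (by nlinarith)]
  -- This is where `λ ≥ -1` is needed, as it is for the radicand in `hsq`.
  have hb0 : 0 ≤ b := by
    rw [hb, sub_nonneg]
    exact Real.le_sqrt_of_sq_le (by linarith)
  -- Lowering the threshold from `b` to `b - δ` gains `ε^{(ξ - ξ') δ}` on the high vertices, which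
  -- absorbs the constant, and costs at most `ε^{-ζ/4}` on the low ones.
  set δ : ℝ := ζ / (4 * (ξ' + b + 1)) with hδ
  have hδ0 : 0 < δ := by positivity
  have hδb : δ * (ξ' + b) ≤ ζ / 4 := by
    rw [hδ, div_mul_eq_mul_div, div_le_iff₀ (by positivity)]
    nlinarith
  refine LFPP.tendsto_measure_one ?_ (hGFF.tendsto_sum_exp b (η := ζ / 4) (by positivity))
  have hsmall := (LFPP.tendsto_const_mul_rpow 1 (mul_pos (sub_pos.2 hlt) hδ0)).add
    (LFPP.tendsto_const_mul_rpow 1 (half_pos hζ))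
  rw [add_zero] at hsmall
  filter_upwards [LFPP.eventually_small one_pos, hsmall.eventually_le_const one_pos]
    with ε ⟨hε, hε1⟩ hone
  intro ω hω
  by_contra hcon
  simp only [Set.mem_ofPred_eq, not_lt] at hcon
  refine hω fun N p hp hinj hL => ?_
  have hmain := LFPP.pathLength_le_of_injective (f := fun z => LFPP.circleAvg h ε z ω) (ξ := ξ)
    (ξ' := ξ') (b := b) (c := (b - δ) * (-Real.log ε)) hε hξ (by linarith) hp hinj
  set E : ℝ := lam - (ξ - ξ') * b - ζ with hE
  have h1 : Real.exp ((ξ - ξ') * ((b - δ) * (-Real.log ε))) * ε ^ (lam - ζ)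
      = ε ^ ((ξ - ξ') * δ) * ε ^ E := by
    rw [Real.rpow_def_of_pos hε, Real.rpow_def_of_pos hε, Real.rpow_def_of_pos hε, ← Real.exp_add,
      ← Real.exp_add, hE]
    congr 1
    ring
  have h2 : ε * Real.exp (-(ξ' + b) * ((b - δ) * (-Real.log ε)))
      * ε ^ (-(2 + b ^ 2 / 2) - ζ / 4) ≤ ε ^ (ζ / 2) * ε ^ E := by
    have he : ε * Real.exp (-(ξ' + b) * ((b - δ) * (-Real.log ε)))
        * ε ^ (-(2 + b ^ 2 / 2) - ζ / 4)
        = ε ^ (1 + (ξ' + b) * (b - δ) + (-(2 + b ^ 2 / 2) - ζ / 4)) := by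
      rw [Real.rpow_add hε, Real.rpow_add hε, Real.rpow_one, Real.rpow_def_of_pos hε ((ξ' + b) * _)]
      congr 3
      ring
    rw [he, ← Real.rpow_add hε]
    refine Real.rpow_le_rpow_of_exponent_ge hε hε1.le ?_
    rw [hE]
    -- By `hsq`, `-1 + ξ' b + b²/2 = lam - (ξ - ξ') b = E + ζ`. The losses `δ (ξ' + b) ≤ ζ/4` and
    -- `ζ/4` leave at least `E + ζ/2`.
    nlinarith
  calc LFPP.pathLength (fun z => LFPP.circleAvg h ε z ω) ε ξ' p
      ≤ Real.exp ((ξ - ξ') * ((b - δ) * (-Real.log ε))) * ε ^ (lam - ζ)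
        + ε * Real.exp (-(ξ' + b) * ((b - δ) * (-Real.log ε)))
          * ε ^ (-(2 + b ^ 2 / 2) - ζ / 4) := hmain.trans (by gcongr)
    _ ≤ ε ^ ((ξ - ξ') * δ) * ε ^ E + ε ^ (ζ / 2) * ε ^ E := by rw [h1]; gcongr
    _ = (1 * ε ^ ((ξ - ξ') * δ) + 1 * ε ^ (ζ / 2)) * ε ^ E := by ring
    _ ≤ ε ^ E := mul_le_of_le_one_left (Real.rpow_pos_of_pos hε _).le hone
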